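/- All Leibniz algebras are right Leibniz algebras over a fixed field $\mathbb F$: $[x,[y,z]]=[[x,y],z]-[[x,z],y]$. A pair $(\mathfrak g,\mathfrak n)$ is a Leibniz algebra $\mathfrak g$ with a two-sided ideal $\mathfrak n$. An action of $\mathfrak g$ on $\mathfrak m$ consists of bilinear maps $(x,m)\mapsto {}^xm$, $(m,x)\mapsto m^x$ into $\mathfrak m$ satisfying ${}^{[x,x']}m={}^x({}^{x'}m)+({}^xm)^{x'}$, $m^{[x,x']}=(m^x)^{x'}-(m^{x'})^x$, ${}^x({}^{x'}m)=-{}^x(m^{x'})$, ${}^x[m,m']=[{}^xm,m']-[{}^xm',m]$, $[m,m']^x=[m^x,m']+[m,m'^x]$, $[m,{}^xm']=-[m,m'^x]$. A crossed module is a homomorphism $\delta:\mathfrak m\to\mathfrak g$ with an action of $\mathfrak g$ on $\mathfrak m$ such that $\delta({}^xm)=[x,\delta(m)]$, $\delta(m^x)=[\delta(m),x]$ and ${}^{\delta(m)}m'=[m,m']=m^{\delta(m')}$. Put $Z(\mathfrak g,\mathfrak m)=\{m : {}^xm=m^x=0\ \forall x\in\mathfrak g\}$ and let $[\mathfrak g,\mathfrak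 m]$ be the span of all ${}^xm$, $m^x$. Let $CL_*(\mathfrak g)$ be the complex $CL_k(\mathfrak g)=\mathfrak g^{\otimes k}$ with $\partial_k(x_1\otimes\cdots\otimes x_k)=\sum_{i<j}(-1)^j x_1\otimes\cdots\otimes[x_i,x_j]\otimes\cdots\otimes\widehat{x_j}\otimes\cdots\otimes x_k$, and let $HL_2(\mathfrak g,\mathfrak n)=H_3(M_*)$, where $M_k=CL_{k-1}(\mathfrak g)\oplus CL_k(\mathfrak g/\mathfrak n)$ with boundary $(a,b)\mapsto(-\partial a,\partial b+\pi_*a)$ is the mapping cone of the projection $\pi_*:CL_*(\mathfrak g)\to CL_*(\mathfrak g/\mathfrak n)$. A crossed module $\delta:\mathfrak m\to\mathfrak g$ is a relative stem cover of $(\mathfrak g,\mathfrak n)$ if $\delta(\mathfrak m)=\mathfrak n$, $\ker\delta\cong HL_2(\mathfrak g,\mathfrak n)$ and $\ker\delta\subseteq Z(\mathfrak g,\mathfrak m)\cap[\mathfrak g,\mathfrak m]$. For Leibniz algebras $\mathfrak p,\mathfrak q$ acting on each other, $\mathfrak p*\mathfrak q$ is the non-abelian tensor product (Gnedbaye): the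 Leibniz algebra generated by the symbols $p*q$ and $q*p$ ($p\in\mathfrak p$, $q\in\mathfrak q$), subject to bilinearity of both kinds of symbols and, for all $p,p'\in\mathfrak p$, $q,q'\in\mathfrak q$, $p*[q,q']=p^q*q'-p^{q'}*q$, $[p,p']*q={}^pq*p'-p*q^{p'}$, $p*{}^{p'}q=-p*q^{p'}$, $p^q*{}^{p'}q'=[p*q,p'*q']={}^pq*p'^{q'}$, $p^q*q'^{p'}=[p*q,q'*p']={}^pq*{}^{q'}p'$, together with the relations obtained from these by exchanging the roles of $\mathfrak p$ and $\mathfrak q$. **Theorem.** Let $(\mathfrak g_i,\mathfrak n_i)$ be a pair of Leibniz algebras and $\delta_i:\mathfrak m_i\to\mathfrak g_i$ a relative stem cover of $(\mathfrak g_i,\mathfrak n_i)$, $i=1,2$. Write $\overline{\mathfrak m}_i=\mathfrak m_i/[\mathfrak g_i,\mathfrak m_i]$ and $\overline{\mathfrak g}_i=\mathfrak g_i/[\mathfrak g_i,\mathfrak g_i]$, with bars also for classes of elements, and form $\overline{\mathfrak m}_1*\overline{\mathfrak g}_2$ and $\overline{\mathfrak g}_1*\overline{\mathfrak m}_2$ with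 the factors acting trivially on each other. Let $\mathfrak a$ be the ideal of $(\overline{\mathfrak m}_1*\overline{\mathfrak g}_2)\oplus(\overline{\mathfrak g}_1*\overline{\mathfrak m}_2)$ generated by the elements $$(\overline m_1*\overline{\delta_2(m_2)},\ \overline m_2*\overline{\delta_1(m_1)}),\qquad(\overline{\delta_2(m_2)}*\overline m_1,\ \overline{\delta_1(m_1)}*\overline m_2)\qquad(m_1\in\mathfrak m_1,\ m_2\in\mathfrak m_2),$$ and let $B$ be the quotient by $\mathfrak a$. On the vector space $\mathfrak m=\mathfrak m_1\oplus\mathfrak m_2\oplus B$ define the bracket $$[(m_1,m_2,z),(m_1',m_2',z')]=([m_1,m_1'],[m_2,m_2'],(\overline m_1'*\overline{\delta_2(m_2)},-\overline{\delta_1(m_1)}*\overline m_2')+\mathfrak a),$$ the action of $\mathfrak g_1\oplus\mathfrak g_2$ $${}^{(x_1,x_2)}(m_1,m_2,z)=({}^{x_1}m_1,{}^{x_2}m_2,(\overline m_1*\overline x_2,-\overline x_1*\overline m_2)+\mathfrak a),$$ $$(m_1,m_2,z)^{(x_1,x_2)}=(m_1^{x_1},m_2^{x_2},(\overline x_2*\overline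 m_1,-\overline m_2*\overline x_1)+\mathfrak a),$$ and the map $\delta(m_1,m_2,z)=(\delta_1(m_1),\delta_2(m_2))$. Then $\delta:\mathfrak m\to\mathfrak g_1\oplus\mathfrak g_2$ is a crossed module of Leibniz algebras, and it is a relative stem cover of the pair $(\mathfrak g_1\oplus\mathfrak g_2,\mathfrak n_1\oplus\mathfrak n_2)$. -/

import Mathlib

open scoped TensorProduct

universe u v w

noncomputable section

/-- A (right) Leibniz algebra over a field `F`: a vector space with a bilinear bracket such that
`[x, [y, z]] = [[x, y], z] - [[x, z], y]`. -/
class LeibnizAlgebra (F : Type u) (L : Type v) [Field F] [AddCommGroup L] [Module F L] where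
  bracket : L →ₗ[F] L →ₗ[F] L
  leibniz : ∀ x y z : L,
    bracket x (bracket y z) = bracket (bracket x y) z - bracket (bracket x z) y

namespace LeibnizAlgebra

/-- The bracket `br F x y = [x, y]`. -/
abbrev br (F : Type u) {L : Type v} [Field F] [AddCommGroup L] [Module F L]
    [LeibnizAlgebra F L] : L →ₗ[F] L →ₗ[F] L :=
  LeibnizAlgebra.bracket

/-- The direct sum of two Leibniz algebras, with componentwise bracket. -/
instance instProd (F : Type u) (L₁ : Type v) (L₂ : Type w) [Field F]
    [AddCommGroup L₁] [Module F L₁] [LeibnizAlgebra F L₁]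
    [AddCommGroup L₂] [Module F L₂] [LeibnizAlgebra F L₂] : LeibnizAlgebra F (L₁ × L₂) where
  bracket := LinearMap.mk₂ F (fun x y => (br F x.1 y.1, br F x.2 y.2))
    (by intros; simp) (by intros; simp) (by intros; simp) (by intros; simp)
  leibniz x y z := by
    simp only [LinearMap.mk₂_apply, Prod.mk_sub_mk, ← LeibnizAlgebra.leibniz]

theorem prod_br {F : Type u} {L₁ : Type v} {L₂ : Type w} [Field F]
    [AddCommGroup L₁] [Module F L₁] [LeibnizAlgebra F L₁]
    [AddCommGroup L₂] [Module F L₂] [LeibnizAlgebra F L₂] (x y : L₁ × L₂) :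
    br F x y = (br F x.1 y.1, br F x.2 y.2) := rfl

end LeibnizAlgebra

open LeibnizAlgebra (br)

/-- A two-sided ideal of a Leibniz algebra. A pair `(g, n)` of Leibniz algebras is a Leibniz
algebra `g` together with such an ideal `n`. -/
structure LeibnizIdeal (F : Type u) (L : Type v) [Field F] [AddCommGroup L] [Module F L]
    [LeibnizAlgebra F L] extends Submodule F L where
  br_mem_right : ∀ (x : L) {y : L}, y ∈ carrier → br F x y ∈ carrier
  br_mem_left : ∀ {x : L} (y : L), x ∈ carrier → br F x y ∈ carrier

namespace LeibnizIdeal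

section

variable {F : Type u} {L : Type v} [Field F] [AddCommGroup L] [Module F L] [LeibnizAlgebra F L]

/-- The bracket induced on the quotient by an ideal. -/
def quotientBracket (I : LeibnizIdeal F L) :
    (L ⧸ I.toSubmodule) →ₗ[F] (L ⧸ I.toSubmodule) →ₗ[F] (L ⧸ I.toSubmodule) :=
  I.toSubmodule.liftQ
    { toFun := fun x => I.toSubmodule.mapQ I.toSubmodule (br F x)
        (fun _ hy => I.br_mem_right x hy)
      map_add' := fun x y => by
        refine Submodule.linearMap_qext _ (LinearMap.ext fun z => ?_)
        simp
      map_smul' := fun c x => by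
        refine Submodule.linearMap_qext _ (LinearMap.ext fun z => ?_)
        simp }
    (fun x hx => by
      rw [LinearMap.mem_ker]
      refine Submodule.linearMap_qext _ (LinearMap.ext fun z => ?_)
      simpa using I.br_mem_left z hx)

/-- The quotient Leibniz algebra by an ideal. -/
instance instQuotient (I : LeibnizIdeal F L) : LeibnizAlgebra F (L ⧸ I.toSubmodule) where
  bracket := I.quotientBracket
  leibniz x y z := by
    induction x using Submodule.Quotient.induction_on with | _ x =>
    induction y using Submodule.Quotient.induction_on with | _ y =>
    induction z using Submodule.Quotient.induction_on with | _ z =>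
    exact congrArg (Submodule.Quotient.mk (p := I.toSubmodule)) (LeibnizAlgebra.leibniz x y z)

theorem br_mk (I : LeibnizIdeal F L) (x y : L) :
    br F (I.toSubmodule.mkQ x) (I.toSubmodule.mkQ y) = I.toSubmodule.mkQ (br F x y) := rfl

/-- The ideal generated by a set. -/
def generatedBy (s : Set L) : LeibnizIdeal F L where
  toSubmodule := sInf {J : Submodule F L | s ⊆ J ∧
    (∀ x y : L, y ∈ J → br F x y ∈ J) ∧ (∀ x y : L, x ∈ J → br F x y ∈ J)}
  br_mem_right x y hy := by
    have hy' := Submodule.mem_sInf.1 hy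
    exact Submodule.mem_sInf.2 fun J hJ => hJ.2.1 x y (hy' J hJ)
  br_mem_left {x} y hx := by
    have hx' := Submodule.mem_sInf.1 hx
    exact Submodule.mem_sInf.2 fun J hJ => hJ.2.2 x y (hx' J hJ)

theorem subset_generatedBy (s : Set L) {x : L} (hx : x ∈ s) :
    x ∈ (generatedBy (F := F) s).toSubmodule :=
  Submodule.mem_sInf.2 fun _ hJ => hJ.1 hx

variable (F L) in
/-- The derived ideal `L² = [L, L]`, spanned by all brackets. -/
def derived : LeibnizIdeal F L where
  toSubmodule := Submodule.span F {z | ∃ x y : L, z = br F x y}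
  br_mem_right x y _ := Submodule.subset_span ⟨x, y, rfl⟩
  br_mem_left {x} y _ := Submodule.subset_span ⟨x, y, rfl⟩

end

/-- The ideal `n₁ ⊕ n₂` of `g₁ ⊕ g₂`. -/
def prod {F : Type u} {L₁ : Type v} {L₂ : Type w} [Field F]
    [AddCommGroup L₁] [Module F L₁] [LeibnizAlgebra F L₁]
    [AddCommGroup L₂] [Module F L₂] [LeibnizAlgebra F L₂]
    (n₁ : LeibnizIdeal F L₁) (n₂ : LeibnizIdeal F L₂) : LeibnizIdeal F (L₁ × L₂) where
  toSubmodule := n₁.toSubmodule.prod n₂.toSubmodule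
  br_mem_right x _ hy := ⟨n₁.br_mem_right x.1 hy.1, n₂.br_mem_right x.2 hy.2⟩
  br_mem_left y hx := ⟨n₁.br_mem_left y.1 hx.1, n₂.br_mem_left y.2 hx.2⟩

end LeibnizIdeal

/-- An action of the Leibniz algebra `X` on the Leibniz algebra `M`; `left x m` is `ˣm` and
`right m x` is `mˣ`. -/
structure LeibnizAction (F : Type u) (X : Type v) (M : Type w) [Field F]
    [AddCommGroup X] [Module F X] [LeibnizAlgebra F X]
    [AddCommGroup M] [Module F M] [LeibnizAlgebra F M] where
  left : X →ₗ[F] M →ₗ[F] M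
  right : M →ₗ[F] X →ₗ[F] M
  br_left : ∀ (x x' : X) (m : M),
    left (br F x x') m = left x (left x' m) + right (left x m) x'
  right_br : ∀ (x x' : X) (m : M),
    right m (br F x x') = right (right m x) x' - right (right m x') x
  left_left : ∀ (x x' : X) (m : M), left x (left x' m) = -left x (right m x')
  left_br : ∀ (x : X) (m m' : M), left x (br F m m') = br F (left x m) m' - br F (left x m') m
  br_right : ∀ (x : X) (m m' : M), right (br F m m') x = br F (right m x) m' + br F m (right m' x)
  br_left' : ∀ (x : X) (m m' : M), br F m (left x m') = -br F m (right m' x)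

/-- The trivial action. -/
def LeibnizAction.trivial (F : Type u) (X : Type v) (M : Type w) [Field F]
    [AddCommGroup X] [Module F X] [LeibnizAlgebra F X]
    [AddCommGroup M] [Module F M] [LeibnizAlgebra F M] : LeibnizAction F X M where
  left := 0
  right := 0
  br_left := by simp
  right_br := by simp
  left_left := by simp
  left_br := by simp
  br_right := by simp
  br_left' := by simp

/-! ### Leibniz algebras given by generators and relations -/

namespace LeibnizPresentation

variable (F : Type u) {X : Type v} [Field F]

/-- The smallest two-sided ideal of the free non-associative algebra on `X` that contains `a - b`
for all pairs related by `r` and that makes the quotient a Leibniz algebra. -/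
def relIdeal (r : FreeNonUnitalNonAssocAlgebra F X → FreeNonUnitalNonAssocAlgebra F X → Prop) :
    Submodule F (FreeNonUnitalNonAssocAlgebra F X) :=
  sInf {J | (∀ a b, r a b → a - b ∈ J) ∧ (∀ a b, b ∈ J → a * b ∈ J) ∧
    (∀ a b, a ∈ J → a * b ∈ J) ∧ ∀ a b c, a * (b * c) - ((a * b) * c - (a * c) * b) ∈ J}

variable {F}
variable (r : FreeNonUnitalNonAssocAlgebra F X → FreeNonUnitalNonAssocAlgebra F X → Prop)

/-- The product induced on the quotient of the free non-associative algebra. -/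
def presentedBracket : (FreeNonUnitalNonAssocAlgebra F X ⧸ relIdeal F r) →ₗ[F]
    (FreeNonUnitalNonAssocAlgebra F X ⧸ relIdeal F r) →ₗ[F]
    (FreeNonUnitalNonAssocAlgebra F X ⧸ relIdeal F r) :=
  (relIdeal F r).liftQ
    { toFun := fun x => (relIdeal F r).mapQ (relIdeal F r)
        (LinearMap.mul F (FreeNonUnitalNonAssocAlgebra F X) x)
        (fun y hy => Submodule.mem_sInf.2 fun J hJ => hJ.2.1 x y (Submodule.mem_sInf.1 hy J hJ))
      map_add' := fun x y => Submodule.linearMap_qext _ (LinearMap.ext fun z =>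
        congrArg (Submodule.Quotient.mk (p := relIdeal F r)) (add_mul x y z))
      map_smul' := fun c x => Submodule.linearMap_qext _ (LinearMap.ext fun z =>
        congrArg (Submodule.Quotient.mk (p := relIdeal F r)) (smul_mul_assoc c x z)) }
    (fun x hx => by
      rw [LinearMap.mem_ker]
      refine Submodule.linearMap_qext _ (LinearMap.ext fun z => ?_)
      have h : x * z ∈ relIdeal F r :=
        Submodule.mem_sInf.2 fun J hJ => hJ.2.2.1 x z (Submodule.mem_sInf.1 hx J hJ)
      exact (Submodule.Quotient.mk_eq_zero _).2 h)

/-- The Leibniz algebra generated by the symbols in `X` subject to the relations `r`. -/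
def Presented : Type (max u v) := FreeNonUnitalNonAssocAlgebra F X ⧸ relIdeal F r

instance : AddCommGroup (Presented r) :=
  inferInstanceAs (AddCommGroup (FreeNonUnitalNonAssocAlgebra F X ⧸ relIdeal F r))

instance : Module F (Presented r) :=
  inferInstanceAs (Module F (FreeNonUnitalNonAssocAlgebra F X ⧸ relIdeal F r))

/-- The class of a non-associative polynomial in the generators. -/
def Presented.mk : FreeNonUnitalNonAssocAlgebra F X →ₗ[F] Presented r := (relIdeal F r).mkQ

theorem Presented.mk_surjective : Function.Surjective (Presented.mk r) :=
  Submodule.mkQ_surjective _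

instance : LeibnizAlgebra F (Presented r) where
  bracket := presentedBracket r
  leibniz x y z := by
    obtain ⟨x, rfl⟩ := Presented.mk_surjective r x
    obtain ⟨y, rfl⟩ := Presented.mk_surjective r y
    obtain ⟨z, rfl⟩ := Presented.mk_surjective r z
    exact (Submodule.Quotient.eq (relIdeal F r)).2
      (Submodule.mem_sInf.2 fun J hJ => hJ.2.2.2 x y z)

theorem Presented.br_mk (a b : FreeNonUnitalNonAssocAlgebra F X) :
    br F (Presented.mk r a) (Presented.mk r b) = Presented.mk r (a * b) := rfl

theorem Presented.mk_eq {a b : FreeNonUnitalNonAssocAlgebra F X} (h : r a b) :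
    Presented.mk r a = Presented.mk r b :=
  (Submodule.Quotient.eq (relIdeal F r)).2 (Submodule.mem_sInf.2 fun _ hJ => hJ.1 a b h)

end LeibnizPresentation

/-! ### The non-abelian tensor product -/

namespace NonabelianTensor

variable {F : Type u} {M : Type v} {N : Type w} [Field F]
  [AddCommGroup M] [Module F M] [LeibnizAlgebra F M]
  [AddCommGroup N] [Module F N] [LeibnizAlgebra F N]

variable (F) in
/-- The symbol `m ∗ n` in the free non-associative algebra. -/
def symL (m : M) (n : N) : FreeNonUnitalNonAssocAlgebra F (M × N ⊕ N × M) :=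
  FreeNonUnitalNonAssocAlgebra.of F (Sum.inl (m, n))

variable (F) in
/-- The symbol `n ∗ m` in the free non-associative algebra. -/
def symR (n : N) (m : M) : FreeNonUnitalNonAssocAlgebra F (M × N ⊕ N × M) :=
  FreeNonUnitalNonAssocAlgebra.of F (Sum.inr (n, m))

/-- The defining relations of the non-abelian tensor product `M ∗ N`, where `N` acts on `M` by `α`
and `M` acts on `N` by `β`. -/
inductive Rel (α : LeibnizAction F N M) (β : LeibnizAction F M N) :
    FreeNonUnitalNonAssocAlgebra F (M × N ⊕ N × M) →
    FreeNonUnitalNonAssocAlgebra F (M × N ⊕ N × M) → Prop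
  | smulL_left (c : F) (m : M) (n : N) : Rel α β (c • symL F m n) (symL F (c • m) n)
  | smulL_right (c : F) (m : M) (n : N) : Rel α β (c • symL F m n) (symL F m (c • n))
  | smulR_left (c : F) (n : N) (m : M) : Rel α β (c • symR F n m) (symR F (c • n) m)
  | smulR_right (c : F) (n : N) (m : M) : Rel α β (c • symR F n m) (symR F n (c • m))
  | addL_left (m m' : M) (n : N) : Rel α β (symL F (m + m') n) (symL F m n + symL F m' n)
  | addR_left (n n' : N) (m : M) : Rel α β (symR F (n + n') m) (symR F n m + symR F n' m)
  | addL_right (m : M) (n n' : N) : Rel α β (symL F m (n + n')) (symL F m n + symL F m n')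
  | addR_right (n : N) (m m' : M) : Rel α β (symR F n (m + m')) (symR F n m + symR F n m')
  | brL_right (m : M) (n n' : N) :
      Rel α β (symL F m (br F n n')) (symL F (α.right m n) n' - symL F (α.right m n') n)
  | brR_right (n : N) (m m' : M) :
      Rel α β (symR F n (br F m m')) (symR F (β.right n m) m' - symR F (β.right n m') m)
  | brL_left (m m' : M) (n : N) :
      Rel α β (symL F (br F m m') n) (symR F (β.left m n) m' - symL F m (β.right n m'))
  | brR_left (n n' : N) (m : M) :
      Rel α β (symR F (br F n n') m) (symL F (α.left n m) n' - symR F n (α.right m n'))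
  | swapL (m m' : M) (n : N) : Rel α β (symL F m (β.left m' n)) (-symL F m (β.right n m'))
  | swapR (n n' : N) (m : M) : Rel α β (symR F n (α.left n' m)) (-symR F n (α.right m n'))
  | mulLL (m m' : M) (n n' : N) :
      Rel α β (symL F (α.right m n) (β.left m' n')) (symL F m n * symL F m' n')
  | mulLL' (m m' : M) (n n' : N) :
      Rel α β (symL F m n * symL F m' n') (symR F (β.left m n) (α.right m' n'))
  | mulRR (m m' : M) (n n' : N) :
      Rel α β (symL F (α.left n m) (β.right n' m')) (symR F n m * symR F n' m')
  | mulRR' (m m' : M) (n n' : N) :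
      Rel α β (symR F n m * symR F n' m') (symR F (β.right n m) (α.left n' m'))
  | mulLR (m m' : M) (n n' : N) :
      Rel α β (symL F (α.right m n) (β.right n' m')) (symL F m n * symR F n' m')
  | mulLR' (m m' : M) (n n' : N) :
      Rel α β (symL F m n * symR F n' m') (symR F (β.left m n) (α.left n' m'))
  | mulRL (m m' : M) (n n' : N) :
      Rel α β (symL F (α.left n m) (β.left m' n')) (symR F n m * symL F m' n')
  | mulRL' (m m' : M) (n n' : N) :
      Rel α β (symR F n m * symL F m' n') (symR F (β.right n m) (α.right m' n'))

end NonabelianTensor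

/-- The non-abelian tensor product `M ∗ N` of Leibniz algebras acting on each other. -/
abbrev NonabelianTensor {F : Type u} {M : Type v} {N : Type w} [Field F]
    [AddCommGroup M] [Module F M] [LeibnizAlgebra F M]
    [AddCommGroup N] [Module F N] [LeibnizAlgebra F N]
    (α : LeibnizAction F N M) (β : LeibnizAction F M N) : Type (max u v w) :=
  LeibnizPresentation.Presented (NonabelianTensor.Rel α β)

namespace NonabelianTensor

open LeibnizPresentation

variable {F : Type u} {M : Type v} {N : Type w} [Field F]
  [AddCommGroup M] [Module F M] [LeibnizAlgebra F M]
  [AddCommGroup N] [Module F N] [LeibnizAlgebra F N]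

/-- The bilinear map `(m, n) ↦ m ∗ n`. -/
def mkL (α : LeibnizAction F N M) (β : LeibnizAction F M N) :
    M →ₗ[F] N →ₗ[F] NonabelianTensor α β :=
  LinearMap.mk₂ F (fun m n => Presented.mk (Rel α β) (symL F m n))
    (fun m m' n => by rw [Presented.mk_eq _ (Rel.addL_left m m' n), map_add])
    (fun c m n => by rw [← Presented.mk_eq _ (Rel.smulL_left c m n), map_smul])
    (fun m n n' => by rw [Presented.mk_eq _ (Rel.addL_right m n n'), map_add])
    (fun c m n => by rw [← Presented.mk_eq _ (Rel.smulL_right c m n), map_smul])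

/-- The bilinear map `(n, m) ↦ n ∗ m`. -/
def mkR (α : LeibnizAction F N M) (β : LeibnizAction F M N) :
    N →ₗ[F] M →ₗ[F] NonabelianTensor α β :=
  LinearMap.mk₂ F (fun n m => Presented.mk (Rel α β) (symR F n m))
    (fun n n' m => by rw [Presented.mk_eq _ (Rel.addR_left n n' m), map_add])
    (fun c n m => by rw [← Presented.mk_eq _ (Rel.smulR_left c n m), map_smul])
    (fun n m m' => by rw [Presented.mk_eq _ (Rel.addR_right n m m'), map_add])
    (fun c n m => by rw [← Presented.mk_eq _ (Rel.smulR_right c n m), map_smul])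

end NonabelianTensor

/-! ### Crossed modules -/

/-- A crossed module of Leibniz algebras `δ : M → G`. -/
structure LeibnizCrossedModule (F : Type u) (M : Type v) (G : Type w) [Field F]
    [AddCommGroup M] [Module F M] [LeibnizAlgebra F M]
    [AddCommGroup G] [Module F G] [LeibnizAlgebra F G] where
  hom : M →ₗ[F] G
  hom_br : ∀ m m' : M, hom (br F m m') = br F (hom m) (hom m')
  act : LeibnizAction F G M
  hom_left : ∀ (x : G) (m : M), hom (act.left x m) = br F x (hom m)
  hom_right : ∀ (x : G) (m : M), hom (act.right m x) = br F (hom m) x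
  left_hom : ∀ m m' : M, act.left (hom m) m' = br F m m'
  right_hom : ∀ m m' : M, act.right m (hom m') = br F m m'

namespace LeibnizCrossedModule

section

variable {F : Type u} {M : Type v} {G : Type w} [Field F]
  [AddCommGroup M] [Module F M] [LeibnizAlgebra F M]
  [AddCommGroup G] [Module F G] [LeibnizAlgebra F G] (δ : LeibnizCrossedModule F M G)

/-- `Z(G, M)`, the elements of `M` on which `G` acts trivially. -/
def center : Submodule F M where
  carrier := {m | ∀ x : G, δ.act.left x m = 0 ∧ δ.act.right m x = 0}
  add_mem' ha hb x := by simp [(ha x).1, (ha x).2, (hb x).1, (hb x).2]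
  zero_mem' x := by simp
  smul_mem' c m hm x := by simp [(hm x).1, (hm x).2]

/-- `[G, M]`, spanned by all `ˣm` and `mˣ`; it is an ideal of `M`. -/
def commutator : LeibnizIdeal F M where
  toSubmodule := Submodule.span F
    ({u | ∃ (x : G) (m : M), u = δ.act.left x m} ∪ {u | ∃ (x : G) (m : M), u = δ.act.right m x})
  br_mem_right m m' _ := Submodule.subset_span (Or.inl ⟨δ.hom m, m', (δ.left_hom m m').symm⟩)
  br_mem_left {m} m' _ := Submodule.subset_span (Or.inr ⟨δ.hom m', m, (δ.right_hom m m').symm⟩)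

end

end LeibnizCrossedModule

/-! ### Second relative homology -/

namespace LeibnizHomology

section

variable {F : Type*} {C₁ C₂ C₃ : Type*} [Field F] [AddCommGroup C₁] [Module F C₁]
    [AddCommGroup C₂] [Module F C₂] [AddCommGroup C₃] [Module F C₃]

/-- The homology `ker g / im f` of two composable linear maps `f`, `g` with `g ∘ f = 0`. -/
def Homology (f : C₁ →ₗ[F] C₂) (g : C₂ →ₗ[F] C₃) : Type _ :=
  LinearMap.ker g ⧸ (LinearMap.range f).submoduleOf (LinearMap.ker g)

instance (f : C₁ →ₗ[F] C₂) (g : C₂ →ₗ[F] C₃) : AddCommGroup (Homology f g) :=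
  inferInstanceAs
    (AddCommGroup (LinearMap.ker g ⧸ (LinearMap.range f).submoduleOf (LinearMap.ker g)))

instance (f : C₁ →ₗ[F] C₂) (g : C₂ →ₗ[F] C₃) : Module F (Homology f g) :=
  inferInstanceAs
    (Module F (LinearMap.ker g ⧸ (LinearMap.range f).submoduleOf (LinearMap.ker g)))

end

section

variable (F : Type u) (L : Type v) [Field F] [AddCommGroup L] [Module F L] [LeibnizAlgebra F L]

/-- The derivation `ω ↦ ∑ᵢ x₁ ⊗ ⋯ ⊗ [xᵢ, z] ⊗ ⋯` on `L ⊗ L`, linear in `z`. -/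
def act2 : L →ₗ[F] (L ⊗[F] L) →ₗ[F] (L ⊗[F] L) :=
  LinearMap.rTensorHom L ∘ₗ (br F).flip + LinearMap.lTensorHom L ∘ₗ (br F).flip

/-- The same derivation on `L ⊗ L ⊗ L`. -/
def act3 : L →ₗ[F] ((L ⊗[F] L) ⊗[F] L) →ₗ[F] ((L ⊗[F] L) ⊗[F] L) :=
  LinearMap.rTensorHom L ∘ₗ act2 F L + LinearMap.lTensorHom (L ⊗[F] L) ∘ₗ (br F).flip

/-- The boundary `∂₂` of the Leibniz complex. -/
def d2 : (L ⊗[F] L) →ₗ[F] L := TensorProduct.lift (br F)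

/-- The boundary `∂₃` of the Leibniz complex. -/
def d3 : ((L ⊗[F] L) ⊗[F] L) →ₗ[F] (L ⊗[F] L) :=
  (d2 F L).rTensor L - TensorProduct.lift (act2 F L).flip

/-- The boundary `∂₄` of the Leibniz complex. -/
def d4 : (((L ⊗[F] L) ⊗[F] L) ⊗[F] L) →ₗ[F] ((L ⊗[F] L) ⊗[F] L) :=
  (d3 F L).rTensor L + TensorProduct.lift (act3 F L).flip

variable {F L}

/-! The boundaries agree with
`∂ₙ(x₁ ⊗ ⋯ ⊗ xₙ) = ∑_{i<j} (-1)ʲ x₁ ⊗ ⋯ ⊗ [xᵢ, xⱼ] ⊗ ⋯ ⊗ x̂ⱼ ⊗ ⋯ ⊗ xₙ`. -/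

theorem d2_tmul (x y : L) : d2 F L (x ⊗ₜ y) = br F x y := rfl

theorem d3_tmul (x y z : L) : d3 F L ((x ⊗ₜ y) ⊗ₜ z) =
    br F x y ⊗ₜ z - br F x z ⊗ₜ y - x ⊗ₜ br F y z := by
  simp [d3, act2, d2_tmul, sub_sub]

theorem d4_tmul (x y z t : L) : d4 F L (((x ⊗ₜ y) ⊗ₜ z) ⊗ₜ t) =
    (br F x y ⊗ₜ z) ⊗ₜ t - (br F x z ⊗ₜ y) ⊗ₜ t - (x ⊗ₜ br F y z) ⊗ₜ t
      + (br F x t ⊗ₜ y) ⊗ₜ z + (x ⊗ₜ br F y t) ⊗ₜ z + (x ⊗ₜ y) ⊗ₜ br F z t := by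
  simp [d4, act3, act2, d3_tmul, TensorProduct.sub_tmul, add_assoc]

end

section

variable {F : Type u} {G : Type v} {Q : Type w} [Field F]
  [AddCommGroup G] [Module F G] [LeibnizAlgebra F G]
  [AddCommGroup Q] [Module F Q] [LeibnizAlgebra F Q] (π : G →ₗ[F] Q)

/-- The boundary `(a, b) ↦ (-∂₂ a, ∂₃ b + π a)` from degree `3` to degree `2` in the mapping cone
of `π : CL(G) → CL(Q)`, whose term in degree `k` is `CLₖ₋₁(G) ⊕ CLₖ(Q)`. -/
def coneD3 : (G ⊗[F] G) × ((Q ⊗[F] Q) ⊗[F] Q) →ₗ[F] G × (Q ⊗[F] Q) :=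
  LinearMap.prod (-(d2 F G ∘ₗ LinearMap.fst F _ _))
    (d3 F Q ∘ₗ LinearMap.snd F _ _ + TensorProduct.map π π ∘ₗ LinearMap.fst F _ _)

/-- The boundary `(a, b) ↦ (-∂₃ a, ∂₄ b + π a)` from degree `4` to degree `3` in the mapping
cone. -/
def coneD4 : ((G ⊗[F] G) ⊗[F] G) × (((Q ⊗[F] Q) ⊗[F] Q) ⊗[F] Q) →ₗ[F]
    (G ⊗[F] G) × ((Q ⊗[F] Q) ⊗[F] Q) :=
  LinearMap.prod (-(d3 F G ∘ₗ LinearMap.fst F _ _))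
    (d4 F Q ∘ₗ LinearMap.snd F _ _ +
      TensorProduct.map (TensorProduct.map π π) π ∘ₗ LinearMap.fst F _ _)

/-- The homology in degree `3` of the mapping cone of `π : CL(G) → CL(Q)`. -/
abbrev ConeH3 : Type (max v w) :=
  Homology (C₁ := ((G ⊗[F] G) ⊗[F] G) × (((Q ⊗[F] Q) ⊗[F] Q) ⊗[F] Q))
    (C₂ := (G ⊗[F] G) × ((Q ⊗[F] Q) ⊗[F] Q)) (C₃ := G × (Q ⊗[F] Q)) (coneD4 π) (coneD3 π)

end

/-- The second relative homology `HL₂(G, n)`: the homology in degree `3` of the mapping cone of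
`CL(G) → CL(G / n)`. -/
abbrev RelHL2 {F : Type u} {G : Type v} [Field F] [AddCommGroup G] [Module F G]
    [LeibnizAlgebra F G] (n : LeibnizIdeal F G) : Type v :=
  ConeH3 n.toSubmodule.mkQ

end LeibnizHomology

/-- A crossed module `δ : M → G` is a relative stem cover of the pair `(G, n)` if `δ(M) = n`,
`ker δ ≅ HL₂(G, n)` and `ker δ ⊆ Z(G, M) ∩ [G, M]`. By the inclusion in `Z(G, M)` the kernel has
zero bracket, and `HL₂(G, n)` is an abelian Leibniz algebra, so an isomorphism between them is the
same as a linear isomorphism. -/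
structure LeibnizCrossedModule.IsRelativeStemCover {F : Type u} {M : Type v} {G : Type w} [Field F]
    [AddCommGroup M] [Module F M] [LeibnizAlgebra F M]
    [AddCommGroup G] [Module F G] [LeibnizAlgebra F G]
    (δ : LeibnizCrossedModule F M G) (n : LeibnizIdeal F G) : Prop where
  range_eq : LinearMap.range δ.hom = n.toSubmodule
  ker_equiv : Nonempty (LinearMap.ker δ.hom ≃ₗ[F] LeibnizHomology.RelHL2 n)
  ker_le : LinearMap.ker δ.hom ≤ δ.center ⊓ δ.commutator.toSubmodule

/-! ### The crossed module `M₁ ∔ M₂ ∔ B → G₁ ⊕ G₂` -/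

namespace LeibnizCrossedModule

/-- `M̄ = M / [G, M]`. -/
abbrev Coinv {F : Type u} {M : Type v} {G : Type w} [Field F]
    [AddCommGroup M] [Module F M] [LeibnizAlgebra F M]
    [AddCommGroup G] [Module F G] [LeibnizAlgebra F G] (δ : LeibnizCrossedModule F M G) : Type v :=
  M ⧸ δ.commutator.toSubmodule

/-- `Ḡ = G / G²`. -/
abbrev Ab (F : Type u) (G : Type w) [Field F] [AddCommGroup G] [Module F G]
    [LeibnizAlgebra F G] : Type w :=
  G ⧸ (LeibnizIdeal.derived F G).toSubmodule

section

variable {F : Type u} {M : Type v} {G : Type w} [Field F]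
  [AddCommGroup M] [Module F M] [LeibnizAlgebra F M]
  [AddCommGroup G] [Module F G] [LeibnizAlgebra F G] (δ : LeibnizCrossedModule F M G)

/-- `m ↦ m̄`. -/
abbrev mbar : M →ₗ[F] δ.Coinv := δ.commutator.toSubmodule.mkQ

variable (F G) in
/-- `x ↦ x̄`. -/
abbrev gbar : G →ₗ[F] Ab F G := (LeibnizIdeal.derived F G).toSubmodule.mkQ

theorem mbar_left (x : G) (m : M) : δ.mbar (δ.act.left x m) = 0 :=
  (Submodule.Quotient.mk_eq_zero _).2 (Submodule.subset_span (Or.inl ⟨x, m, rfl⟩))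

theorem mbar_right (x : G) (m : M) : δ.mbar (δ.act.right m x) = 0 :=
  (Submodule.Quotient.mk_eq_zero _).2 (Submodule.subset_span (Or.inr ⟨x, m, rfl⟩))

theorem mbar_br (m m' : M) : δ.mbar (br F m m') = 0 := by
  rw [← δ.left_hom]; exact δ.mbar_left _ _

theorem gbar_br (x y : G) : gbar F G (br F x y) = 0 :=
  (Submodule.Quotient.mk_eq_zero _).2 (Submodule.subset_span ⟨x, y, rfl⟩)

end

section

variable {F : Type*} {M₁ M₂ G₁ G₂ : Type*} [Field F]
  [AddCommGroup M₁] [Module F M₁] [LeibnizAlgebra F M₁]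
  [AddCommGroup M₂] [Module F M₂] [LeibnizAlgebra F M₂]
  [AddCommGroup G₁] [Module F G₁] [LeibnizAlgebra F G₁]
  [AddCommGroup G₂] [Module F G₂] [LeibnizAlgebra F G₂]
  (δ₁ : LeibnizCrossedModule F M₁ G₁) (δ₂ : LeibnizCrossedModule F M₂ G₂)

/-- `M̄₁ ∗ Ḡ₂`, the factors acting trivially on each other. -/
abbrev TensorMG : Type _ :=
  NonabelianTensor (LeibnizAction.trivial F (Ab F G₂) δ₁.Coinv)
    (LeibnizAction.trivial F δ₁.Coinv (Ab F G₂))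

/-- `Ḡ₁ ∗ M̄₂`, the factors acting trivially on each other. -/
abbrev TensorGM : Type _ :=
  NonabelianTensor (LeibnizAction.trivial F δ₂.Coinv (Ab F G₁))
    (LeibnizAction.trivial F (Ab F G₁) δ₂.Coinv)

variable (G₂) in
/-- `(m₁, x₂) ↦ m̄₁ ∗ x̄₂ ∈ M̄₁ ∗ Ḡ₂`. -/
def tMG : M₁ →ₗ[F] G₂ →ₗ[F] TensorMG (G₂ := G₂) δ₁ :=
  (NonabelianTensor.mkL _ _).compl₁₂ δ₁.mbar (gbar F G₂)

variable (G₂) in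
/-- `(x₂, m₁) ↦ x̄₂ ∗ m̄₁ ∈ M̄₁ ∗ Ḡ₂`. -/
def tMG' : G₂ →ₗ[F] M₁ →ₗ[F] TensorMG (G₂ := G₂) δ₁ :=
  (NonabelianTensor.mkR _ _).compl₁₂ (gbar F G₂) δ₁.mbar

variable (G₁) in
/-- `(x₁, m₂) ↦ x̄₁ ∗ m̄₂ ∈ Ḡ₁ ∗ M̄₂`. -/
def tGM : G₁ →ₗ[F] M₂ →ₗ[F] TensorGM (G₁ := G₁) δ₂ :=
  (NonabelianTensor.mkL _ _).compl₁₂ (gbar F G₁) δ₂.mbar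

variable (G₁) in
/-- `(m₂, x₁) ↦ m̄₂ ∗ x̄₁ ∈ Ḡ₁ ∗ M̄₂`. -/
def tGM' : M₂ →ₗ[F] G₁ →ₗ[F] TensorGM (G₁ := G₁) δ₂ :=
  (NonabelianTensor.mkR _ _).compl₁₂ δ₂.mbar (gbar F G₁)

/-- The ideal `𝔞` of `(M̄₁ ∗ Ḡ₂) ⊕ (Ḡ₁ ∗ M̄₂)` generated by all `(m̄₁ ∗ ȳ₂, m̄₂ ∗ ȳ₁)` and
`(ȳ₂ ∗ m̄₁, ȳ₁ ∗ m̄₂)`, where `y₁ = δ₁ m₁` and `y₂ = δ₂ m₂`. -/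
def idealA : LeibnizIdeal F (TensorMG (G₂ := G₂) δ₁ × TensorGM (G₁ := G₁) δ₂) :=
  LeibnizIdeal.generatedBy
    ({u | ∃ (m₁ : M₁) (m₂ : M₂), u = (tMG G₂ δ₁ m₁ (δ₂.hom m₂), tGM' G₁ δ₂ m₂ (δ₁.hom m₁))} ∪
      {u | ∃ (m₁ : M₁) (m₂ : M₂), u = (tMG' G₂ δ₁ (δ₂.hom m₂) m₁, tGM G₁ δ₂ (δ₁.hom m₁) m₂)})

/-- `B = ((M̄₁ ∗ Ḡ₂) ⊕ (Ḡ₁ ∗ M̄₂)) / 𝔞`. -/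
abbrev B : Type _ :=
  (TensorMG (G₂ := G₂) δ₁ × TensorGM (G₁ := G₁) δ₂) ⧸ (idealA δ₁ δ₂).toSubmodule

/-- `(x, m) ↦ (m̄₁ ∗ x̄₂, -x̄₁ ∗ m̄₂)`. -/
def leftT : G₁ × G₂ →ₗ[F] M₁ × M₂ →ₗ[F] TensorMG (G₂ := G₂) δ₁ × TensorGM (G₁ := G₁) δ₂ :=
  LinearMap.mk₂ F (fun x m => (tMG G₂ δ₁ m.1 x.2, -tGM G₁ δ₂ x.1 m.2))
    (fun x y m => Prod.ext (map_add _ _ _) (by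
      change -tGM G₁ δ₂ (x.1 + y.1) m.2 = -tGM G₁ δ₂ x.1 m.2 + -tGM G₁ δ₂ y.1 m.2
      rw [map_add, LinearMap.add_apply, neg_add]))
    (fun c x m => Prod.ext (map_smul _ _ _) (by
      change -tGM G₁ δ₂ (c • x.1) m.2 = c • -tGM G₁ δ₂ x.1 m.2
      rw [map_smul, LinearMap.smul_apply, smul_neg]))
    (fun x m m' => Prod.ext (LinearMap.map_add₂ _ _ _ _) (by
      change -tGM G₁ δ₂ x.1 (m.2 + m'.2) = -tGM G₁ δ₂ x.1 m.2 + -tGM G₁ δ₂ x.1 m'.2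
      rw [map_add, neg_add]))
    (fun c x m => Prod.ext (LinearMap.map_smul₂ _ _ _ _) (by
      change -tGM G₁ δ₂ x.1 (c • m.2) = c • -tGM G₁ δ₂ x.1 m.2
      rw [map_smul, smul_neg]))

/-- `(m, x) ↦ (x̄₂ ∗ m̄₁, -m̄₂ ∗ x̄₁)`. -/
def rightT : M₁ × M₂ →ₗ[F] G₁ × G₂ →ₗ[F] TensorMG (G₂ := G₂) δ₁ × TensorGM (G₁ := G₁) δ₂ :=
  LinearMap.mk₂ F (fun m x => (tMG' G₂ δ₁ x.2 m.1, -tGM' G₁ δ₂ m.2 x.1))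
    (fun m m' x => Prod.ext (map_add _ _ _) (by
      change -tGM' G₁ δ₂ (m.2 + m'.2) x.1 = -tGM' G₁ δ₂ m.2 x.1 + -tGM' G₁ δ₂ m'.2 x.1
      rw [map_add, LinearMap.add_apply, neg_add]))
    (fun c m x => Prod.ext (map_smul _ _ _) (by
      change -tGM' G₁ δ₂ (c • m.2) x.1 = c • -tGM' G₁ δ₂ m.2 x.1
      rw [map_smul, LinearMap.smul_apply, smul_neg]))
    (fun m x y => Prod.ext (LinearMap.map_add₂ _ _ _ _) (by
      change -tGM' G₁ δ₂ m.2 (x.1 + y.1) = -tGM' G₁ δ₂ m.2 x.1 + -tGM' G₁ δ₂ m.2 y.1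
      rw [map_add, neg_add]))
    (fun c m x => Prod.ext (LinearMap.map_smul₂ _ _ _ _) (by
      change -tGM' G₁ δ₂ m.2 (c • x.1) = c • -tGM' G₁ δ₂ m.2 x.1
      rw [map_smul, smul_neg]))

/-- `(m̄₁ ∗ x̄₂, -x̄₁ ∗ m̄₂) + 𝔞`, the `B`-component of the left action of `G₁ ⊕ G₂`. -/
def leftB : G₁ × G₂ →ₗ[F] M₁ × M₂ →ₗ[F] B δ₁ δ₂ :=
  (leftT δ₁ δ₂).compr₂ (idealA δ₁ δ₂).toSubmodule.mkQ

/-- `(x̄₂ ∗ m̄₁, -m̄₂ ∗ x̄₁) + 𝔞`, the `B`-component of the right action of `G₁ ⊕ G₂`. -/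
def rightB : M₁ × M₂ →ₗ[F] G₁ × G₂ →ₗ[F] B δ₁ δ₂ :=
  (rightT δ₁ δ₂).compr₂ (idealA δ₁ δ₂).toSubmodule.mkQ

theorem leftB_apply (x : G₁ × G₂) (m : M₁ × M₂) : leftB δ₁ δ₂ x m =
    (idealA δ₁ δ₂).toSubmodule.mkQ (tMG G₂ δ₁ m.1 x.2, -tGM G₁ δ₂ x.1 m.2) := rfl

theorem rightB_apply (m : M₁ × M₂) (x : G₁ × G₂) : rightB δ₁ δ₂ m x =
    (idealA δ₁ δ₂).toSubmodule.mkQ (tMG' G₂ δ₁ x.2 m.1, -tGM' G₁ δ₂ m.2 x.1) := rfl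

theorem leftB_eq_zero (x : G₁ × G₂) {m : M₁ × M₂} (h₁ : δ₁.mbar m.1 = 0) (h₂ : δ₂.mbar m.2 = 0) :
    leftB δ₁ δ₂ x m = 0 := by
  have e₁ : tMG G₂ δ₁ m.1 x.2 = 0 := by
    rw [tMG, LinearMap.compl₁₂_apply, h₁, map_zero, LinearMap.zero_apply]
  have e₂ : tGM G₁ δ₂ x.1 m.2 = 0 := by rw [tGM, LinearMap.compl₁₂_apply, h₂, map_zero]
  rw [leftB_apply, e₁, e₂, neg_zero]; exact map_zero _

theorem rightB_eq_zero (x : G₁ × G₂) {m : M₁ × M₂} (h₁ : δ₁.mbar m.1 = 0)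
    (h₂ : δ₂.mbar m.2 = 0) : rightB δ₁ δ₂ m x = 0 := by
  have e₁ : tMG' G₂ δ₁ x.2 m.1 = 0 := by rw [tMG', LinearMap.compl₁₂_apply, h₁, map_zero]
  have e₂ : tGM' G₁ δ₂ m.2 x.1 = 0 := by
    rw [tGM', LinearMap.compl₁₂_apply, h₂, map_zero, LinearMap.zero_apply]
  rw [rightB_apply, e₁, e₂, neg_zero]; exact map_zero _

theorem leftB_br (x y : G₁ × G₂) (m : M₁ × M₂) : leftB δ₁ δ₂ (br F x y) m = 0 := by
  have e₁ : tMG G₂ δ₁ m.1 (br F x.2 y.2) = 0 := by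
    rw [tMG, LinearMap.compl₁₂_apply, gbar_br, map_zero]
  have e₂ : tGM G₁ δ₂ (br F x.1 y.1) m.2 = 0 := by
    rw [tGM, LinearMap.compl₁₂_apply, gbar_br, map_zero, LinearMap.zero_apply]
  rw [leftB_apply, LeibnizAlgebra.prod_br, e₁, e₂, neg_zero]; exact map_zero _

theorem rightB_br (x y : G₁ × G₂) (m : M₁ × M₂) : rightB δ₁ δ₂ m (br F x y) = 0 := by
  have e₁ : tMG' G₂ δ₁ (br F x.2 y.2) m.1 = 0 := by
    rw [tMG', LinearMap.compl₁₂_apply, gbar_br, map_zero, LinearMap.zero_apply]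
  have e₂ : tGM' G₁ δ₂ m.2 (br F x.1 y.1) = 0 := by
    rw [tGM', LinearMap.compl₁₂_apply, gbar_br, map_zero]
  rw [rightB_apply, LeibnizAlgebra.prod_br, e₁, e₂, neg_zero]; exact map_zero _

/-- Both crossed-module expressions for the `B`-component of the bracket agree. -/
theorem rightB_hom (m m' : M₁ × M₂) :
    rightB δ₁ δ₂ m (δ₁.hom m'.1, δ₂.hom m'.2) = leftB δ₁ δ₂ (δ₁.hom m.1, δ₂.hom m.2) m' := by
  rw [rightB_apply, leftB_apply, ← sub_eq_zero, ← map_sub]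
  refine (Submodule.Quotient.mk_eq_zero _).2 ?_
  have h₁ := LeibnizIdeal.subset_generatedBy (F := F)
    ({u | ∃ (m₁ : M₁) (m₂ : M₂), u = (tMG G₂ δ₁ m₁ (δ₂.hom m₂), tGM' G₁ δ₂ m₂ (δ₁.hom m₁))} ∪
      {u | ∃ (m₁ : M₁) (m₂ : M₂), u = (tMG' G₂ δ₁ (δ₂.hom m₂) m₁, tGM G₁ δ₂ (δ₁.hom m₁) m₂)})
    (Or.inl ⟨m'.1, m.2, rfl⟩)
  have h₂ := LeibnizIdeal.subset_generatedBy (F := F)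
    ({u | ∃ (m₁ : M₁) (m₂ : M₂), u = (tMG G₂ δ₁ m₁ (δ₂.hom m₂), tGM' G₁ δ₂ m₂ (δ₁.hom m₁))} ∪
      {u | ∃ (m₁ : M₁) (m₂ : M₂), u = (tMG' G₂ δ₁ (δ₂.hom m₂) m₁, tGM G₁ δ₂ (δ₁.hom m₁) m₂)})
    (Or.inr ⟨m.1, m'.2, rfl⟩)
  have e : ((tMG' G₂ δ₁ (δ₂.hom m'.2) m.1, -tGM' G₁ δ₂ m.2 (δ₁.hom m'.1)) :
        TensorMG (G₂ := G₂) δ₁ × TensorGM (G₁ := G₁) δ₂) -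
      (tMG G₂ δ₁ m'.1 (δ₂.hom m.2), -tGM G₁ δ₂ (δ₁.hom m.1) m'.2) =
      (tMG' G₂ δ₁ (δ₂.hom m'.2) m.1, tGM G₁ δ₂ (δ₁.hom m.1) m'.2) -
      (tMG G₂ δ₁ m'.1 (δ₂.hom m.2), tGM' G₁ δ₂ m.2 (δ₁.hom m'.1)) :=
    Prod.ext rfl (neg_sub_neg _ _)
  exact e ▸ Submodule.sub_mem _ h₂ h₁

/-- The underlying vector space of `M₁ ∔ M₂ ∔ B`. -/
def DirectSum : Type _ := (M₁ × M₂) × B δ₁ δ₂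

instance : AddCommGroup (DirectSum δ₁ δ₂) := inferInstanceAs (AddCommGroup ((M₁ × M₂) × B δ₁ δ₂))

instance : Module F (DirectSum δ₁ δ₂) := inferInstanceAs (Module F ((M₁ × M₂) × B δ₁ δ₂))

/-- The projection `(m₁, m₂, z) ↦ (m₁, m₂)`. -/
def DirectSum.toM : DirectSum δ₁ δ₂ →ₗ[F] M₁ × M₂ := LinearMap.fst F (M₁ × M₂) (B δ₁ δ₂)

/-- The projection `(m₁, m₂, z) ↦ z`. -/
def DirectSum.toB : DirectSum δ₁ δ₂ →ₗ[F] B δ₁ δ₂ := LinearMap.snd F (M₁ × M₂) (B δ₁ δ₂)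

/-- The element `(m₁, m₂, z)`. -/
def DirectSum.mk (m : M₁ × M₂) (z : B δ₁ δ₂) : DirectSum δ₁ δ₂ := (m, z)

@[simp] theorem DirectSum.toM_mk (m : M₁ × M₂) (z : B δ₁ δ₂) : toM δ₁ δ₂ (mk δ₁ δ₂ m z) = m := rfl

@[simp] theorem DirectSum.toB_mk (m : M₁ × M₂) (z : B δ₁ δ₂) : toB δ₁ δ₂ (mk δ₁ δ₂ m z) = z := rfl

variable {δ₁ δ₂} in
theorem DirectSum.ext {u v : DirectSum δ₁ δ₂} (h₁ : toM δ₁ δ₂ u = toM δ₁ δ₂ v)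
    (h₂ : toB δ₁ δ₂ u = toB δ₁ δ₂ v) : u = v := Prod.ext h₁ h₂

/-- The direct sum crossed module `M₁ ⊕ M₂ → G₁ ⊕ G₂`, with everything componentwise. -/
def prod : LeibnizCrossedModule F (M₁ × M₂) (G₁ × G₂) where
  hom := LinearMap.prodMap δ₁.hom δ₂.hom
  hom_br _ _ := Prod.ext (δ₁.hom_br _ _) (δ₂.hom_br _ _)
  act :=
    { left := LinearMap.mk₂ F (fun x m => (δ₁.act.left x.1 m.1, δ₂.act.left x.2 m.2))
        (fun _ _ _ => Prod.ext (LinearMap.map_add₂ _ _ _ _) (LinearMap.map_add₂ _ _ _ _))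
        (fun _ _ _ => Prod.ext (LinearMap.map_smul₂ _ _ _ _) (LinearMap.map_smul₂ _ _ _ _))
        (fun _ _ _ => Prod.ext (map_add _ _ _) (map_add _ _ _))
        (fun _ _ _ => Prod.ext (map_smul _ _ _) (map_smul _ _ _))
      right := LinearMap.mk₂ F (fun m x => (δ₁.act.right m.1 x.1, δ₂.act.right m.2 x.2))
        (fun _ _ _ => Prod.ext (LinearMap.map_add₂ _ _ _ _) (LinearMap.map_add₂ _ _ _ _))
        (fun _ _ _ => Prod.ext (LinearMap.map_smul₂ _ _ _ _) (LinearMap.map_smul₂ _ _ _ _))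
        (fun _ _ _ => Prod.ext (map_add _ _ _) (map_add _ _ _))
        (fun _ _ _ => Prod.ext (map_smul _ _ _) (map_smul _ _ _))
      br_left := fun _ _ _ => Prod.ext (δ₁.act.br_left _ _ _) (δ₂.act.br_left _ _ _)
      right_br := fun _ _ _ => Prod.ext (δ₁.act.right_br _ _ _) (δ₂.act.right_br _ _ _)
      left_left := fun _ _ _ => Prod.ext (δ₁.act.left_left _ _ _) (δ₂.act.left_left _ _ _)
      left_br := fun _ _ _ => Prod.ext (δ₁.act.left_br _ _ _) (δ₂.act.left_br _ _ _)
      br_right := fun _ _ _ => Prod.ext (δ₁.act.br_right _ _ _) (δ₂.act.br_right _ _ _)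
      br_left' := fun _ _ _ => Prod.ext (δ₁.act.br_left' _ _ _) (δ₂.act.br_left' _ _ _) }
  hom_left _ _ := Prod.ext (δ₁.hom_left _ _) (δ₂.hom_left _ _)
  hom_right _ _ := Prod.ext (δ₁.hom_right _ _) (δ₂.hom_right _ _)
  left_hom _ _ := Prod.ext (δ₁.left_hom _ _) (δ₂.left_hom _ _)
  right_hom _ _ := Prod.ext (δ₁.right_hom _ _) (δ₂.right_hom _ _)

/-- `(m₁, m₂, z) ↦ (δ₁ m₁, δ₂ m₂)`. -/
def sumHom : DirectSum δ₁ δ₂ →ₗ[F] G₁ × G₂ := (prod δ₁ δ₂).hom ∘ₗ DirectSum.toM δ₁ δ₂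

/-- `⁽ˣ¹,ˣ²⁾(m₁, m₂, z) = (ˣ¹m₁, ˣ²m₂, (m̄₁ ∗ x̄₂, -x̄₁ ∗ m̄₂) + 𝔞)`. -/
def sumLeft : G₁ × G₂ →ₗ[F] DirectSum δ₁ δ₂ →ₗ[F] DirectSum δ₁ δ₂ :=
  LinearMap.mk₂ F
    (fun x u => DirectSum.mk δ₁ δ₂ ((prod δ₁ δ₂).act.left x (DirectSum.toM δ₁ δ₂ u))
      (leftB δ₁ δ₂ x (DirectSum.toM δ₁ δ₂ u)))
    (fun _ _ _ => by
      apply DirectSum.ext <;>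
        simp only [DirectSum.toM_mk, DirectSum.toB_mk, map_add, LinearMap.add_apply])
    (fun _ _ _ => by
      apply DirectSum.ext <;>
        simp only [DirectSum.toM_mk, DirectSum.toB_mk, map_smul, LinearMap.smul_apply])
    (fun _ _ _ => by
      apply DirectSum.ext <;>
        simp only [DirectSum.toM_mk, DirectSum.toB_mk, map_add])
    (fun _ _ _ => by
      apply DirectSum.ext <;>
        simp only [DirectSum.toM_mk, DirectSum.toB_mk, map_smul])

/-- `(m₁, m₂, z)⁽ˣ¹,ˣ²⁾ = (m₁ˣ¹, m₂ˣ², (x̄₂ ∗ m̄₁, -m̄₂ ∗ x̄₁) + 𝔞)`. -/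
def sumRight : DirectSum δ₁ δ₂ →ₗ[F] G₁ × G₂ →ₗ[F] DirectSum δ₁ δ₂ :=
  LinearMap.mk₂ F
    (fun u x => DirectSum.mk δ₁ δ₂ ((prod δ₁ δ₂).act.right (DirectSum.toM δ₁ δ₂ u) x)
      (rightB δ₁ δ₂ (DirectSum.toM δ₁ δ₂ u) x))
    (fun _ _ _ => by
      apply DirectSum.ext <;>
        simp only [DirectSum.toM_mk, DirectSum.toB_mk, map_add, LinearMap.add_apply])
    (fun _ _ _ => by
      apply DirectSum.ext <;>
        simp only [DirectSum.toM_mk, DirectSum.toB_mk, map_smul, LinearMap.smul_apply])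
    (fun _ _ _ => by
      apply DirectSum.ext <;>
        simp only [DirectSum.toM_mk, DirectSum.toB_mk, map_add])
    (fun _ _ _ => by
      apply DirectSum.ext <;>
        simp only [DirectSum.toM_mk, DirectSum.toB_mk, map_smul])

/-- `[(m₁, m₂, z), (m₁', m₂', z')] = ([m₁, m₁'], [m₂, m₂'], (m̄₁' ∗ ȳ₂, -ȳ₁ ∗ m̄₂') + 𝔞)`, where
`y₁ = δ₁ m₁` and `y₂ = δ₂ m₂`. -/
def sumBracket : DirectSum δ₁ δ₂ →ₗ[F] DirectSum δ₁ δ₂ →ₗ[F] DirectSum δ₁ δ₂ :=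
  LinearMap.mk₂ F
    (fun u v => DirectSum.mk δ₁ δ₂ (br F (DirectSum.toM δ₁ δ₂ u) (DirectSum.toM δ₁ δ₂ v))
      (leftB δ₁ δ₂ (sumHom δ₁ δ₂ u) (DirectSum.toM δ₁ δ₂ v)))
    (fun _ _ _ => by
      apply DirectSum.ext <;>
        simp only [DirectSum.toM_mk, DirectSum.toB_mk, map_add, LinearMap.add_apply])
    (fun _ _ _ => by
      apply DirectSum.ext <;>
        simp only [DirectSum.toM_mk, DirectSum.toB_mk, map_smul, LinearMap.smul_apply])
    (fun _ _ _ => by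
      apply DirectSum.ext <;>
        simp only [DirectSum.toM_mk, DirectSum.toB_mk, map_add])
    (fun _ _ _ => by
      apply DirectSum.ext <;>
        simp only [DirectSum.toM_mk, DirectSum.toB_mk, map_smul])

theorem sumHom_apply (u : DirectSum δ₁ δ₂) :
    sumHom δ₁ δ₂ u = (prod δ₁ δ₂).hom (DirectSum.toM δ₁ δ₂ u) := rfl

theorem sumLeft_apply (x : G₁ × G₂) (u : DirectSum δ₁ δ₂) : sumLeft δ₁ δ₂ x u =
    DirectSum.mk δ₁ δ₂ ((prod δ₁ δ₂).act.left x (DirectSum.toM δ₁ δ₂ u))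
      (leftB δ₁ δ₂ x (DirectSum.toM δ₁ δ₂ u)) := rfl

theorem sumRight_apply (u : DirectSum δ₁ δ₂) (x : G₁ × G₂) : sumRight δ₁ δ₂ u x =
    DirectSum.mk δ₁ δ₂ ((prod δ₁ δ₂).act.right (DirectSum.toM δ₁ δ₂ u) x)
      (rightB δ₁ δ₂ (DirectSum.toM δ₁ δ₂ u) x) := rfl

theorem sumBracket_apply (u v : DirectSum δ₁ δ₂) : sumBracket δ₁ δ₂ u v =
    DirectSum.mk δ₁ δ₂ (br F (DirectSum.toM δ₁ δ₂ u) (DirectSum.toM δ₁ δ₂ v))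
      (leftB δ₁ δ₂ (sumHom δ₁ δ₂ u) (DirectSum.toM δ₁ δ₂ v)) := rfl

theorem leftB_left (x y : G₁ × G₂) (m : M₁ × M₂) :
    leftB δ₁ δ₂ x ((prod δ₁ δ₂).act.left y m) = 0 :=
  leftB_eq_zero δ₁ δ₂ x (δ₁.mbar_left _ _) (δ₂.mbar_left _ _)

theorem leftB_right (x y : G₁ × G₂) (m : M₁ × M₂) :
    leftB δ₁ δ₂ x ((prod δ₁ δ₂).act.right m y) = 0 :=
  leftB_eq_zero δ₁ δ₂ x (δ₁.mbar_right _ _) (δ₂.mbar_right _ _)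

theorem rightB_left (x y : G₁ × G₂) (m : M₁ × M₂) :
    rightB δ₁ δ₂ ((prod δ₁ δ₂).act.left y m) x = 0 :=
  rightB_eq_zero δ₁ δ₂ x (δ₁.mbar_left _ _) (δ₂.mbar_left _ _)

theorem rightB_right (x y : G₁ × G₂) (m : M₁ × M₂) :
    rightB δ₁ δ₂ ((prod δ₁ δ₂).act.right m y) x = 0 :=
  rightB_eq_zero δ₁ δ₂ x (δ₁.mbar_right _ _) (δ₂.mbar_right _ _)

theorem leftB_br' (x : G₁ × G₂) (m m' : M₁ × M₂) : leftB δ₁ δ₂ x (br F m m') = 0 :=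
  leftB_eq_zero δ₁ δ₂ x (δ₁.mbar_br _ _) (δ₂.mbar_br _ _)

theorem rightB_br' (x : G₁ × G₂) (m m' : M₁ × M₂) : rightB δ₁ δ₂ (br F m m') x = 0 :=
  rightB_eq_zero δ₁ δ₂ x (δ₁.mbar_br _ _) (δ₂.mbar_br _ _)

theorem leftB_hom_br (m m' m'' : M₁ × M₂) :
    leftB δ₁ δ₂ ((prod δ₁ δ₂).hom (br F m m')) m'' = 0 := by
  rw [hom_br]; exact leftB_br δ₁ δ₂ _ _ _

theorem leftB_hom_left (x : G₁ × G₂) (m m' : M₁ × M₂) :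
    leftB δ₁ δ₂ ((prod δ₁ δ₂).hom ((prod δ₁ δ₂).act.left x m)) m' = 0 := by
  rw [hom_left]; exact leftB_br δ₁ δ₂ _ _ _

theorem leftB_hom_right (x : G₁ × G₂) (m m' : M₁ × M₂) :
    leftB δ₁ δ₂ ((prod δ₁ δ₂).hom ((prod δ₁ δ₂).act.right m x)) m' = 0 := by
  rw [hom_right]; exact leftB_br δ₁ δ₂ _ _ _

instance : LeibnizAlgebra F (DirectSum δ₁ δ₂) where
  bracket := sumBracket δ₁ δ₂
  leibniz u v w := by
    apply DirectSum.ext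
    · simp only [sumBracket_apply, DirectSum.toM_mk, map_sub]
      exact LeibnizAlgebra.leibniz _ _ _
    · simp only [sumBracket_apply, sumHom_apply, DirectSum.toM_mk, DirectSum.toB_mk, map_sub,
        leftB_br', leftB_hom_br, sub_zero]

theorem br_apply (u v : DirectSum δ₁ δ₂) : br F u v =
    DirectSum.mk δ₁ δ₂ (br F (DirectSum.toM δ₁ δ₂ u) (DirectSum.toM δ₁ δ₂ v))
      (leftB δ₁ δ₂ (sumHom δ₁ δ₂ u) (DirectSum.toM δ₁ δ₂ v)) := rfl

/-- The action of `G₁ ⊕ G₂` on `M₁ ∔ M₂ ∔ B`. -/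
def sumAction : LeibnizAction F (G₁ × G₂) (DirectSum δ₁ δ₂) where
  left := sumLeft δ₁ δ₂
  right := sumRight δ₁ δ₂
  br_left x x' u := by
    apply DirectSum.ext
    · simp only [sumLeft_apply, sumRight_apply, DirectSum.toM_mk, map_add,
        (prod δ₁ δ₂).act.br_left]
    · simp only [sumLeft_apply, sumRight_apply, DirectSum.toM_mk, DirectSum.toB_mk, map_add,
        leftB_br, leftB_left, rightB_left, add_zero]
  right_br x x' u := by
    apply DirectSum.ext
    · simp only [sumRight_apply, DirectSum.toM_mk, map_sub, (prod δ₁ δ₂).act.right_br]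
    · simp only [sumRight_apply, DirectSum.toM_mk, DirectSum.toB_mk, map_sub, rightB_br,
        rightB_right, sub_zero]
  left_left x x' u := by
    apply DirectSum.ext
    · simp only [sumLeft_apply, sumRight_apply, DirectSum.toM_mk, map_neg]
      exact (prod δ₁ δ₂).act.left_left _ _ _
    · simp only [sumLeft_apply, sumRight_apply, DirectSum.toM_mk, DirectSum.toB_mk, map_neg,
        leftB_left, leftB_right, neg_zero]
  left_br x u v := by
    apply DirectSum.ext
    · simp only [sumLeft_apply, br_apply, DirectSum.toM_mk, map_sub, (prod δ₁ δ₂).act.left_br]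
    · simp only [sumLeft_apply, br_apply, sumHom_apply, DirectSum.toM_mk, DirectSum.toB_mk,
        map_sub, leftB_br', leftB_hom_left, sub_zero]
  br_right x u v := by
    apply DirectSum.ext
    · simp only [sumRight_apply, br_apply, DirectSum.toM_mk, map_add, (prod δ₁ δ₂).act.br_right]
    · simp only [sumRight_apply, br_apply, sumHom_apply, DirectSum.toM_mk, DirectSum.toB_mk,
        map_add, rightB_br', leftB_hom_right, leftB_right, add_zero]
  br_left' x u v := by
    apply DirectSum.ext
    · simp only [sumLeft_apply, sumRight_apply, br_apply, DirectSum.toM_mk, map_neg]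
      exact (prod δ₁ δ₂).act.br_left' _ _ _
    · simp only [sumLeft_apply, sumRight_apply, br_apply, DirectSum.toM_mk, DirectSum.toB_mk,
        map_neg, leftB_left, leftB_right, neg_zero]

/-- The crossed module `M₁ ∔ M₂ ∔ B → G₁ ⊕ G₂`. -/
def sum : LeibnizCrossedModule F (DirectSum δ₁ δ₂) (G₁ × G₂) where
  hom := sumHom δ₁ δ₂
  hom_br u v := by simp only [br_apply, sumHom_apply, DirectSum.toM_mk, (prod δ₁ δ₂).hom_br]
  act := sumAction δ₁ δ₂
  hom_left x u := (prod δ₁ δ₂).hom_left x (DirectSum.toM δ₁ δ₂ u)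
  hom_right x u := (prod δ₁ δ₂).hom_right x (DirectSum.toM δ₁ δ₂ u)
  left_hom u v := by
    change sumLeft δ₁ δ₂ (sumHom δ₁ δ₂ u) v = _
    rw [sumLeft_apply, br_apply, sumHom_apply, (prod δ₁ δ₂).left_hom]
  right_hom u v := by
    change sumRight δ₁ δ₂ u (sumHom δ₁ δ₂ v) = _
    rw [sumRight_apply, br_apply, sumHom_apply, sumHom_apply, (prod δ₁ δ₂).right_hom]
    exact congrArg _ (rightB_hom δ₁ δ₂ (DirectSum.toM δ₁ δ₂ u) (DirectSum.toM δ₁ δ₂ v))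

end

end LeibnizCrossedModule

end

/-! The kernel of `δ` is `ker δ₁ ⊕ ker δ₂ ⊕ B`, and `ker δᵢ ≅ HL₂(gᵢ, nᵢ)`, so the heart of the
matter is a Künneth formula: `HL₂(g₁ ⊕ g₂, n₁ ⊕ n₂) ≅ HL₂(g₁, n₁) ⊕ HL₂(g₂, n₂) ⊕ B`
(`exists_kerH2_prod_equiv`).

Since `CL(g) → CL(g/n)` is surjective, the mapping cone may be replaced by the kernel complex
(`kerH2Equiv`): `HL₂(g, n)` is the space of 2-cycles in `ker (π ⊗ π)` modulo `∂₃` of `ker (π ⊗ π ⊗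
π)`. For `g = g₁ ⊕ g₂` the 2-chains split into four blocks. The diagonal blocks give the `HL₂(gᵢ,
nᵢ)`. In the mixed blocks `∂₂` vanishes, so the relative cycles in `g₁ ⊗ g₂` form `n₁ ⊗ g₂ + g₁ ⊗
n₂`, and boundaries only kill tensors with a suitable bracket in one factor.

On the other side, with trivial actions the non-abelian tensor products have zero bracket and are
spanned by the symbols. Hence `B` is the target of universal bilinear symbols (`exists_lift_B`). The
symbols `m̄₁ ∗ x̄₂` and `-m̄₂ ∗ x̄₁` stand for `δ₁m₁ ⊗ x₂` and `x₁ ⊗ δ₂m₂`, while `x̄₂ ∗ m̄₁` and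
`-x̄₁ ∗ m̄₂` describe the block `g₂ ⊗ g₁`. The relations `𝔞` say that the two descriptions of `δ₁m₁
⊗ δ₂m₂`, and of `δ₂m₂ ⊗ δ₁m₁`, agree.

Injectivity of the map from `B` to homology rests on two facts: `ker δᵢ ⊆ [gᵢ, mᵢ]`, so the symbols
vanish on `ker δᵢ`, and over a field `n₁ ⊗ g₂ ∩ g₁ ⊗ n₂ = n₁ ⊗ n₂`, so gluing along `m₁ ⊗ m₂`
suffices (`lift_add_lift_eq_zero`, then `lift_add_lift_eq_zero_of_boundary`).

The stem condition holds because the `B`-component of the action depends only on classes modulo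
`[gᵢ, mᵢ]`, and because every symbol of `B` is the action of one summand on the other
(`mem_center_sum`, `inB_mem_commutator`). -/

noncomputable section

open LeibnizAlgebra (br)

namespace LeibnizHomology

open LinearMap TensorProduct

/-! ### Kernels of tensor products of linear maps over a field -/

section TensorKernels

variable {F : Type*} [Field F]
  {A A' B B' C : Type*} [AddCommGroup A] [Module F A] [AddCommGroup A'] [Module F A']
  [AddCommGroup B] [Module F B] [AddCommGroup B'] [Module F B'] [AddCommGroup C] [Module F C]

theorem range_lTensor_sup_range_rTensor_le {A₀ B₀ : Type*} [AddCommGroup A₀] [Module F A₀]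
    [AddCommGroup B₀] [Module F B₀] {i : A₀ →ₗ[F] A} {j : B₀ →ₗ[F] B} {S : Submodule F (A ⊗[F] B)}
    (hi : ∀ a b, i a ⊗ₜ b ∈ S) (hj : ∀ a b, a ⊗ₜ j b ∈ S) :
    range (lTensor A j) ⊔ range (rTensor B i) ≤ S := by
  refine sup_le ?_ ?_
  · rintro _ ⟨t, rfl⟩
    induction t with
    | zero => simp
    | tmul a b => simpa using hj a b
    | add s t hs ht => rw [map_add]; exact S.add_mem hs ht
  · rintro _ ⟨t, rfl⟩
    induction t with
    | zero => simp
    | tmul a b => simpa using hi a b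
    | add s t hs ht => rw [map_add]; exact S.add_mem hs ht

/-- Over a field, the kernel of `f ⊗ g` is `ker f ⊗ B + A ⊗ ker g`. -/
theorem ker_map_of_exact {A₀ B₀ : Type*} [AddCommGroup A₀] [Module F A₀]
    [AddCommGroup B₀] [Module F B₀] {i : A₀ →ₗ[F] A} {j : B₀ →ₗ[F] B}
    {f : A →ₗ[F] A'} {g : B →ₗ[F] B'} (hi : Function.Exact i f) (hj : Function.Exact j g) :
    ker (map f g) = range (lTensor A j) ⊔ range (rTensor B i) := by
  have hi' : Function.Exact i f.rangeRestrict := fun x => by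
    rw [← hi x, Subtype.ext_iff]; rfl
  have hj' : Function.Exact j g.rangeRestrict := fun x => by
    rw [← hj x, Subtype.ext_iff]; rfl
  rw [← TensorProduct.map_ker hi' f.surjective_rangeRestrict hj' g.surjective_rangeRestrict]
  -- Right exactness describes the kernel for surjections only. A general `f ⊗ g` factors through
  -- the ranges, and the inclusion of the ranges stays injective after tensoring, by flatness.
  have e : map f g = map (range f).subtype (range g).subtype ∘ₗ
      map f.rangeRestrict g.rangeRestrict := by
    rw [← map_comp]; rfl
  rw [e, ker_comp_of_ker_eq_bot]
  exact ker_eq_bot.2 (TensorProduct.map_injective_of_flat_flat _ _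
    (Submodule.subtype_injective _) (Submodule.subtype_injective _))

theorem ker_map_le {f : A →ₗ[F] A'} {g : B →ₗ[F] B'} {S : Submodule F (A ⊗[F] B)}
    (hf : ∀ a ∈ ker f, ∀ b, a ⊗ₜ b ∈ S) (hg : ∀ a, ∀ b ∈ ker g, a ⊗ₜ b ∈ S) :
    ker (map f g) ≤ S := by
  rw [ker_map_of_exact f.exact_subtype_ker_map g.exact_subtype_ker_map]
  exact range_lTensor_sup_range_rTensor_le (fun a b => hf a a.2 b) (fun a b => hg a b b.2)

/-- Over a field, a pair of bilinear maps on `M₁ × G₂` and `G₁ × M₂` that agree on `M₁ × M₂` and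
vanish on `ker δ₁` and `ker δ₂` factors through the sum of the images of `M₁ ⊗ G₂` and `G₁ ⊗ M₂`
in `G₁ ⊗ G₂`. -/
theorem lift_add_lift_eq_zero {M₁ M₂ G₁ G₂ V : Type*} [AddCommGroup M₁] [Module F M₁]
    [AddCommGroup M₂] [Module F M₂] [AddCommGroup G₁] [Module F G₁] [AddCommGroup G₂] [Module F G₂]
    [AddCommGroup V] [Module F V] (d₁ : M₁ →ₗ[F] G₁) (d₂ : M₂ →ₗ[F] G₂)
    (f : M₁ →ₗ[F] G₂ →ₗ[F] V) (g : G₁ →ₗ[F] M₂ →ₗ[F] V)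
    (hf : ∀ m ∈ ker d₁, ∀ x, f m x = 0) (hg : ∀ x, ∀ m ∈ ker d₂, g x m = 0)
    (hfg : ∀ m m', f m (d₂ m') = g (d₁ m) m') (a : M₁ ⊗[F] G₂) (b : G₁ ⊗[F] M₂)
    (h : rTensor G₂ d₁ a + lTensor G₁ d₂ b = 0) : lift f a + lift g b = 0 := by
  -- Modulo `range d₂` in the second factor the `b` term disappears, so `a` is a sum of a tensor
  -- from `M₁ ⊗ M₂` and one from `ker d₁ ⊗ G₂`.
  have ha : a ∈ ker (map d₁ (range d₂).mkQ) := by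
    have h' := congrArg (lTensor G₁ (range d₂).mkQ) h
    rw [map_add, map_zero, ← comp_apply, ← comp_apply, lTensor_comp_rTensor, ← lTensor_comp,
      (LinearMap.exact_map_mkQ_range d₂).linearMap_comp_eq_zero, lTensor_zero, LinearMap.zero_apply,
      add_zero] at h'
    exact h'
  rw [ker_map_of_exact d₁.exact_subtype_ker_map (LinearMap.exact_map_mkQ_range d₂)] at ha
  obtain ⟨_, ⟨c, rfl⟩, _, ⟨k, rfl⟩, rfl⟩ := Submodule.mem_sup.1 ha
  have hk : lift f ∘ₗ rTensor G₂ (ker d₁).subtype = 0 := by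
    ext m x; simpa using hf m m.2 x
  have hk' : rTensor G₂ d₁ ∘ₗ rTensor G₂ (ker d₁).subtype = 0 := by
    rw [← rTensor_comp, d₁.exact_subtype_ker_map.linearMap_comp_eq_zero, rTensor_zero]
  have hc : lift f ∘ₗ lTensor M₁ d₂ = lift g ∘ₗ rTensor M₂ d₁ := by
    ext m m'; simpa using hfg m m'
  have hc' : rTensor G₂ d₁ ∘ₗ lTensor M₁ d₂ = lTensor G₁ d₂ ∘ₗ rTensor M₂ d₁ := by
    rw [rTensor_comp_lTensor, lTensor_comp_rTensor]
  -- The part `k` from `ker d₁` drops out, and the part `c` from `M₁ ⊗ M₂` is moved to the `G₁ ⊗ M₂`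
  -- side, where `h` places it together with `b` in the kernel of `id ⊗ d₂`, that is, in the image
  -- of `G₁ ⊗ ker d₂`.
  rw [map_add, ← comp_apply, ← comp_apply (rTensor G₂ d₁) (rTensor _ _), hk', hc', LinearMap.zero_apply, add_zero,
    comp_apply, ← map_add] at h
  obtain ⟨s, hs⟩ := (Module.Flat.lTensor_exact G₁ d₂.exact_subtype_ker_map _).1 h
  rw [map_add, ← comp_apply, ← comp_apply (lift f) (rTensor _ _), hk, hc, LinearMap.zero_apply, add_zero, comp_apply,
    ← map_add, ← hs, ← comp_apply]
  have hs' : lift g ∘ₗ lTensor G₁ (ker d₂).subtype = 0 := by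
    ext x m; simpa using hg x m m.2
  rw [hs', LinearMap.zero_apply]

end TensorKernels

/-! ### The Leibniz complex in low degrees -/

section Homology

variable {F : Type*} {C₁ C₂ C₃ : Type*} [Field F] [AddCommGroup C₁] [Module F C₁]
    [AddCommGroup C₂] [Module F C₂] [AddCommGroup C₃] [Module F C₃]
    (f : C₁ →ₗ[F] C₂) (g : C₂ →ₗ[F] C₃)

/-- The class of a cycle. -/
def Homology.mk : ker g →ₗ[F] Homology f g := ((range f).submoduleOf (ker g)).mkQ

theorem Homology.mk_surjective : Function.Surjective (Homology.mk f g) :=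
  Submodule.mkQ_surjective _

theorem Homology.mk_eq_zero {z : ker g} : Homology.mk f g z = 0 ↔ (z : C₂) ∈ range f :=
  Submodule.Quotient.mk_eq_zero _

end Homology

section Complex

variable {F : Type u} {G : Type v} {Q : Type w} [Field F]
  [AddCommGroup G] [Module F G] [LeibnizAlgebra F G]
  [AddCommGroup Q] [Module F Q] [LeibnizAlgebra F Q]

theorem d2_comp_d3 : d2 F G ∘ₗ d3 F G = 0 := by
  ext x y z
  simp [d3_tmul, d2_tmul, LeibnizAlgebra.leibniz x y z]

/-- Rewriting every `[x, [y, z]]` by the Leibniz identity leaves only left-normed brackets, and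
these cancel in pairs. -/
theorem d3_comp_d4 : d3 F G ∘ₗ d4 F G = 0 := by
  ext x y z t
  simp only [TensorProduct.AlgebraTensorModule.curry_apply, restrictScalars_self, curry_apply,
    comp_apply, d4_tmul, map_add, map_sub, d3_tmul, LeibnizAlgebra.leibniz, LinearMap.zero_apply,
    tmul_sub, sub_tmul]
  abel

theorem d2_d3 (c : (G ⊗[F] G) ⊗[F] G) : d2 F G (d3 F G c) = 0 := congr($d2_comp_d3 c)

theorem d3_d4 (c : ((G ⊗[F] G) ⊗[F] G) ⊗[F] G) : d3 F G (d4 F G c) = 0 := congr($d3_comp_d4 c)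

variable {f : G →ₗ[F] Q} (hf : ∀ x y, f (br F x y) = br F (f x) (f y))
include hf

theorem d2_map (a : G ⊗[F] G) : d2 F Q (map f f a) = f (d2 F G a) := by
  have : d2 F Q ∘ₗ map f f = f ∘ₗ d2 F G := by
    ext x y; simp [d2_tmul, hf]
  exact congr($this a)

theorem d3_map (a : (G ⊗[F] G) ⊗[F] G) :
    d3 F Q (map (map f f) f a) = map f f (d3 F G a) := by
  have : d3 F Q ∘ₗ map (map f f) f = map f f ∘ₗ d3 F G := by
    ext x y z; simp [d3_tmul, hf]
  exact congr($this a)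

theorem d4_map (a : ((G ⊗[F] G) ⊗[F] G) ⊗[F] G) :
    d4 F Q (map (map (map f f) f) f a) = map (map f f) f (d4 F G a) := by
  have : d4 F Q ∘ₗ map (map (map f f) f) f = map (map f f) f ∘ₗ d4 F G := by
    ext x y z t; simp [d4_tmul, hf]
  exact congr($this a)

end Complex

/-! ### Relative homology as homology of the kernel complex -/

section Relative

variable {F : Type u} {G : Type v} {Q : Type w} [Field F]
  [AddCommGroup G] [Module F G] [LeibnizAlgebra F G]
  [AddCommGroup Q] [Module F Q] (π : G →ₗ[F] Q)

/-- The cycles of degree `2` in the kernel of `CL(G) → CL(Q)`. -/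
def relCycles : Submodule F (G ⊗[F] G) := ker (d2 F G) ⊓ ker (map π π)

/-- The boundaries of degree `2` in the kernel of `CL(G) → CL(Q)`. -/
def relBoundaries : Submodule F (G ⊗[F] G) := (ker (map (map π π) π)).map (d3 F G)

/-- The homology in degree `2` of the kernel of `CL(G) → CL(Q)`. -/
abbrev KerH2 : Type v := relCycles π ⧸ (relBoundaries π).submoduleOf (relCycles π)

variable {π}

theorem mem_relCycles {a : G ⊗[F] G} : a ∈ relCycles π ↔ d2 F G a = 0 ∧ map π π a = 0 := Iff.rfl

/-- To check that a submodule contains the kernel of `G ⊗ G ⊗ G → Q ⊗ Q ⊗ Q`, it suffices to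
consider pure tensors with one entry in the kernel of `G → Q`. -/
theorem ker_map_map_le {S : Submodule F ((G ⊗[F] G) ⊗[F] G)}
    (h₁ : ∀ x ∈ ker π, ∀ y z, (x ⊗ₜ y) ⊗ₜ z ∈ S) (h₂ : ∀ x, ∀ y ∈ ker π, ∀ z, (x ⊗ₜ y) ⊗ₜ z ∈ S)
    (h₃ : ∀ x y, ∀ z ∈ ker π, (x ⊗ₜ y) ⊗ₜ z ∈ S) : ker (map (map π π) π) ≤ S := by
  refine ker_map_le (fun a ha z => ?_) (fun a z hz => ?_)
  · have : ker (map π π) ≤ S.comap ((TensorProduct.mk F (G ⊗[F] G) G).flip z) :=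
      ker_map_le (fun x hx y => h₁ x hx y z) (fun x y hy => h₂ x y hy z)
    exact this ha
  · induction a with
    | zero => simp
    | tmul x y => exact h₃ x y z hz
    | add s t hs ht => rw [add_tmul]; exact S.add_mem hs ht

variable [LeibnizAlgebra F Q]

theorem coneD3_apply (a : G ⊗[F] G) (b : (Q ⊗[F] Q) ⊗[F] Q) :
    coneD3 π (a, b) = (-d2 F G a, d3 F Q b + map π π a) := rfl

theorem coneD4_apply (a : (G ⊗[F] G) ⊗[F] G) (b : ((Q ⊗[F] Q) ⊗[F] Q) ⊗[F] Q) :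
    coneD4 π (a, b) = (-d3 F G a, d4 F Q b + map (map π π) π a) := rfl

variable (π) in
/-- The inclusion of the relative cycles into the cycles of the mapping cone, `a ↦ (a, 0)`. -/
def relCyclesToCone : relCycles π →ₗ[F] ker (coneD3 π) :=
  codRestrict _ (inl F _ _ ∘ₗ (relCycles π).subtype) fun a => by
    simp [coneD3, (mem_relCycles.1 a.2).1, (mem_relCycles.1 a.2).2]

variable (π) in
/-- The class map from the relative cycles to the homology of the mapping cone. -/
def relCyclesToConeH3 : relCycles π →ₗ[F] ConeH3 π :=
  Homology.mk _ _ ∘ₗ relCyclesToCone π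

theorem relCyclesToConeH3_eq_zero {a : relCycles π} :
    relCyclesToConeH3 π a = 0 ↔ ((a : G ⊗[F] G), (0 : (Q ⊗[F] Q) ⊗[F] Q)) ∈ range (coneD4 π) := by
  rw [relCyclesToConeH3, comp_apply, Homology.mk_eq_zero]; rfl

variable (hf : ∀ x y, π (br F x y) = br F (π x) (π y)) (hπ : Function.Surjective π)
include hf hπ

/-- Lifting the second entry of a cone cycle `(a, b)` to a chain `c` of `G`, the cone boundary of
`(-c, 0)` moves the cycle to `(a + ∂₃c, 0)`. -/
theorem relCyclesToConeH3_surjective : Function.Surjective (relCyclesToConeH3 π) := by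
  intro t
  obtain ⟨⟨⟨a, b⟩, hab⟩, rfl⟩ := Homology.mk_surjective _ _ t
  obtain ⟨c, rfl⟩ := map_surjective (map_surjective hπ hπ) hπ b
  have h := mem_ker.1 hab
  rw [coneD3_apply, Prod.mk_eq_zero, neg_eq_zero, d3_map hf, ← map_add] at h
  refine ⟨⟨a + d3 F G c, mem_relCycles.2 ⟨by rw [map_add, h.1, d2_d3, add_zero], ?_⟩⟩, ?_⟩
  · rw [add_comm, h.2]
  · rw [← sub_eq_zero, relCyclesToConeH3, comp_apply, ← map_sub, Homology.mk_eq_zero]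
    refine ⟨(-c, 0), ?_⟩
    change _ = (a + d3 F G c, (0 : (Q ⊗[F] Q) ⊗[F] Q)) - (a, map (map π π) π c)
    simp [coneD4_apply]

/-- If `(a, 0)` bounds `(c, e)` in the cone, a lift of `e` to `G` corrects `c` by a `∂₄`-boundary so
that it lies in the kernel of the projection. This does not change `∂₃c`, because `∂₃∂₄ = 0`. -/
theorem ker_relCyclesToConeH3 :
    ker (relCyclesToConeH3 π) = (relBoundaries π).submoduleOf (relCycles π) := by
  ext ⟨a, ha⟩
  rw [mem_ker, relCyclesToConeH3_eq_zero]
  refine ⟨?_, ?_⟩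
  · rintro ⟨⟨c, e⟩, h⟩
    obtain ⟨e, rfl⟩ := map_surjective (map_surjective (map_surjective hπ hπ) hπ) hπ e
    rw [coneD4_apply, d4_map hf, ← map_add, Prod.mk.injEq] at h
    refine ⟨-(d4 F G e + c), neg_mem (mem_ker.2 h.2), ?_⟩
    rw [map_neg, map_add, d3_d4, zero_add]; exact h.1
  · rintro ⟨c, hc, h⟩
    refine ⟨(-c, 0), ?_⟩
    rw [coneD4_apply, map_neg, map_neg, neg_neg, mem_ker.1 hc, map_zero, neg_zero, zero_add]
    exact congrArg (·, _) h

/-- The homology of the mapping cone of a surjection is the homology of its kernel. -/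
def kerH2Equiv : KerH2 π ≃ₗ[F] ConeH3 π :=
  Submodule.quotEquivOfEq _ _ (ker_relCyclesToConeH3 hf hπ).symm ≪≫ₗ
    (relCyclesToConeH3 π).quotKerEquivOfSurjective (relCyclesToConeH3_surjective hf hπ)

end Relative

/-! ### Functoriality of relative cycles and boundaries -/

section Functoriality

variable {F : Type*} {G G' Q Q' : Type*} [Field F]
  [AddCommGroup G] [Module F G] [LeibnizAlgebra F G]
  [AddCommGroup G'] [Module F G'] [LeibnizAlgebra F G']
  [AddCommGroup Q] [Module F Q] [AddCommGroup Q'] [Module F Q']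
  {π : G →ₗ[F] Q} {π' : G' →ₗ[F] Q'} {f : G →ₗ[F] G'} {g : Q →ₗ[F] Q'}

theorem map_mem_relCycles (hf : ∀ x y, f (br F x y) = br F (f x) (f y))
    (hfg : π' ∘ₗ f = g ∘ₗ π) {a : G ⊗[F] G} (ha : a ∈ relCycles π) :
    map f f a ∈ relCycles π' := by
  refine mem_relCycles.2 ⟨by rw [d2_map hf, (mem_relCycles.1 ha).1, map_zero], ?_⟩
  rw [map_map, hfg, ← map_map, (mem_relCycles.1 ha).2, map_zero]

theorem map_mem_relBoundaries (hf : ∀ x y, f (br F x y) = br F (f x) (f y))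
    (hfg : π' ∘ₗ f = g ∘ₗ π) {a : G ⊗[F] G} (ha : a ∈ relBoundaries π) :
    map f f a ∈ relBoundaries π' := by
  obtain ⟨c, hc, rfl⟩ := ha
  refine ⟨map (map f f) f c, mem_ker.2 ?_, d3_map hf c⟩
  rw [map_map, ← map_comp, hfg, map_comp, ← map_map, mem_ker.1 hc, map_zero]

end Functoriality

end LeibnizHomology

/-! ### The non-abelian tensor product for trivial actions -/

/-- A vector space regarded as a non-unital algebra with zero multiplication. -/
def ZeroMul (V : Type*) := V

namespace ZeroMul

variable {F V : Type*} [Field F] [AddCommGroup V] [Module F V]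

instance : AddCommGroup (ZeroMul V) := inferInstanceAs (AddCommGroup V)

instance : Module F (ZeroMul V) := inferInstanceAs (Module F V)

instance : NonUnitalNonAssocRing (ZeroMul V) :=
  { (inferInstance : AddCommGroup (ZeroMul V)) with
    mul := fun _ _ => 0
    left_distrib := fun _ _ _ => (add_zero (0 : ZeroMul V)).symm
    right_distrib := fun _ _ _ => (add_zero (0 : ZeroMul V)).symm
    zero_mul := fun _ => rfl
    mul_zero := fun _ => rfl }

theorem mul_eq_zero (a b : ZeroMul V) : a * b = 0 := rfl

instance : IsScalarTower F (ZeroMul V) (ZeroMul V) :=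
  ⟨fun c a b => by rw [smul_eq_mul, smul_eq_mul, mul_eq_zero, mul_eq_zero, smul_zero]⟩

instance : SMulCommClass F (ZeroMul V) (ZeroMul V) :=
  ⟨fun c a b => by rw [smul_eq_mul, smul_eq_mul, mul_eq_zero, mul_eq_zero, smul_zero]⟩

variable (F V) in
/-- The identity map. -/
def equiv : V ≃ₗ[F] ZeroMul V where
  toFun v := v
  invFun v := v
  map_add' _ _ := rfl
  map_smul' _ _ := rfl

end ZeroMul

namespace NonabelianTensor

open LeibnizPresentation

section

variable {F : Type u} {M : Type v} {N : Type w} [Field F]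
  [AddCommGroup M] [Module F M] [LeibnizAlgebra F M]
  [AddCommGroup N] [Module F N] [LeibnizAlgebra F N]
  {V : Type*} [AddCommGroup V] [Module F V]

variable (F M N) in
/-- The non-abelian tensor product of two algebras that act trivially on each other. -/
abbrev TrivialTensor :=
  NonabelianTensor (LeibnizAction.trivial F N M) (LeibnizAction.trivial F M N)

/-- The span of the symbols `m ∗ n` and `n ∗ m`. -/
def symbols (α : LeibnizAction F N M) (β : LeibnizAction F M N) :
    Submodule F (NonabelianTensor α β) :=
  LinearMap.range (TensorProduct.lift (mkL α β)) ⊔ LinearMap.range (TensorProduct.lift (mkR α β))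

theorem symbols_le {α : LeibnizAction F N M} {β : LeibnizAction F M N}
    {S : Submodule F (NonabelianTensor α β)} (h₁ : ∀ m n, mkL α β m n ∈ S)
    (h₂ : ∀ n m, mkR α β n m ∈ S) : symbols α β ≤ S := by
  refine sup_le ?_ ?_
  · rintro _ ⟨t, rfl⟩
    induction t with
    | zero => simp
    | tmul m n => exact h₁ m n
    | add s t hs ht => rw [map_add]; exact S.add_mem hs ht
  · rintro _ ⟨t, rfl⟩
    induction t with
    | zero => simp
    | tmul m n => exact h₂ m n
    | add s t hs ht => rw [map_add]; exact S.add_mem hs ht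

/-- Each product of two symbols is, by a defining relation, a symbol with an entry such as `m^n` or
`ⁿm`, which is zero for the trivial actions. -/
theorem br_eq_zero_of_mem_symbols {s t : TrivialTensor F M N} (hs : s ∈ symbols _ _)
    (ht : t ∈ symbols _ _) : br F s t = 0 := by
  have e {a b} := Presented.mk_eq (a := a) (b := b)
    (Rel (LeibnizAction.trivial F N M) (LeibnizAction.trivial F M N))
  have hL (m : M) (n : N) : symbols _ _ ≤
      LinearMap.ker (br F (mkL (LeibnizAction.trivial F N M) (LeibnizAction.trivial F M N) m n)) :=
    symbols_le
      (fun m' n' => (e (Rel.mulLL m m' n n')).symm.trans (LinearMap.map_zero₂ (mkL _ _) _))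
      (fun n' m' => (e (Rel.mulLR m m' n n')).symm.trans (LinearMap.map_zero₂ (mkL _ _) _))
  have hR (m : M) (n : N) : symbols _ _ ≤
      LinearMap.ker (br F (mkR (LeibnizAction.trivial F N M) (LeibnizAction.trivial F M N) n m)) :=
    symbols_le
      (fun m' n' => (e (Rel.mulRL m m' n n')).symm.trans (LinearMap.map_zero₂ (mkL _ _) _))
      (fun n' m' => (e (Rel.mulRR m m' n n')).symm.trans (LinearMap.map_zero₂ (mkL _ _) _))
  have h : symbols _ _ ≤ LinearMap.ker ((br F (L := TrivialTensor F M N)).flip t) :=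
    symbols_le (fun m n => hL m n ht) (fun n m => hR m n ht)
  exact h hs

/-- The preimage of the span of symbols in the free algebra is a subalgebra, since products of its
elements map to zero. It contains the generators, so it is everything. -/
theorem mem_symbols (t : TrivialTensor F M N) : t ∈ symbols _ _ := by
  obtain ⟨a, rfl⟩ := Presented.mk_surjective _ t
  let S : NonUnitalSubalgebra F (FreeNonUnitalNonAssocAlgebra F (M × N ⊕ N × M)) :=
    { (symbols _ _).comap (Presented.mk (Rel (LeibnizAction.trivial F N M)
        (LeibnizAction.trivial F M N))) with
      mul_mem' := fun {a b} ha hb => by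
        change Presented.mk _ (a * b) ∈ symbols _ _
        rw [← Presented.br_mk, br_eq_zero_of_mem_symbols ha hb]
        exact zero_mem _ }
  have hS (x : M × N ⊕ N × M) : FreeNonUnitalNonAssocAlgebra.of F x ∈ S := by
    obtain ⟨m, n⟩ | ⟨n, m⟩ := x
    · exact Submodule.mem_sup_left ⟨m ⊗ₜ n, rfl⟩
    · exact Submodule.mem_sup_right ⟨n ⊗ₜ m, rfl⟩
  -- Structural induction through the universal property: the lift into `S` followed by the
  -- inclusion fixes the generators, so it is the identity and every element lies in `S`.
  have h : (NonUnitalSubalgebraClass.subtype S).comp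
      (FreeNonUnitalNonAssocAlgebra.lift F fun x => (⟨_, hS x⟩ : S)) = NonUnitalAlgHom.id F _ := by
    refine FreeNonUnitalNonAssocAlgebra.hom_ext F fun x => ?_
    exact congrArg Subtype.val (FreeNonUnitalNonAssocAlgebra.lift_of_apply F _ x)
  have ha : (FreeNonUnitalNonAssocAlgebra.lift F (fun x => (⟨_, hS x⟩ : S)) a : _) = a :=
    congr($h a)
  rw [← ha]
  exact (FreeNonUnitalNonAssocAlgebra.lift F (fun x => (⟨_, hS x⟩ : S)) a).2

theorem br_eq_zero (s t : TrivialTensor F M N) : br F s t = 0 :=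
  br_eq_zero_of_mem_symbols (mem_symbols s) (mem_symbols t)

/-- The linear map on the free algebra that vanishes on products and has given values on the
symbols. -/
def freeLift (f : M →ₗ[F] N →ₗ[F] V) (g : N →ₗ[F] M →ₗ[F] V) :
    FreeNonUnitalNonAssocAlgebra F (M × N ⊕ N × M) →ₗ[F] V :=
  (ZeroMul.equiv F V).symm ∘ₗ (FreeNonUnitalNonAssocAlgebra.lift F fun x : M × N ⊕ N × M =>
    ZeroMul.equiv F V (Sum.elim (fun y => f y.1 y.2) (fun y => g y.1 y.2) x) : _ →ₗ[F] ZeroMul V)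

theorem freeLift_symL (f : M →ₗ[F] N →ₗ[F] V) (g : N →ₗ[F] M →ₗ[F] V) (m : M) (n : N) :
    freeLift f g (symL F m n) = f m n :=
  congrArg (ZeroMul.equiv F V).symm (FreeNonUnitalNonAssocAlgebra.lift_of_apply F _ _)

theorem freeLift_symR (f : M →ₗ[F] N →ₗ[F] V) (g : N →ₗ[F] M →ₗ[F] V) (n : N) (m : M) :
    freeLift f g (symR F n m) = g n m :=
  congrArg (ZeroMul.equiv F V).symm (FreeNonUnitalNonAssocAlgebra.lift_of_apply F _ _)

theorem freeLift_mul (f : M →ₗ[F] N →ₗ[F] V) (g : N →ₗ[F] M →ₗ[F] V)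
    (a b : FreeNonUnitalNonAssocAlgebra F (M × N ⊕ N × M)) : freeLift f g (a * b) = 0 :=
  congrArg (ZeroMul.equiv F V).symm (map_mul (FreeNonUnitalNonAssocAlgebra.lift F _) a b)

/-- If the brackets of the factors vanish, a pair of bilinear maps induces a linear map on the
non-abelian tensor product for the trivial actions. -/
def lift (hM : ∀ m m' : M, br F m m' = 0) (hN : ∀ n n' : N, br F n n' = 0)
    (f : M →ₗ[F] N →ₗ[F] V) (g : N →ₗ[F] M →ₗ[F] V) : TrivialTensor F M N →ₗ[F] V :=
  (relIdeal F _).liftQ (freeLift f g) <| by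
    -- The kernel of `freeLift f g` is one of the subspaces in the infimum defining `relIdeal`. Its
    -- closure conditions and the Leibniz identity hold because `freeLift` kills all products.
    refine sInf_le ⟨fun a b h => ?_, fun a b _ => freeLift_mul f g a b,
      fun a b _ => freeLift_mul f g a b, fun a b c => ?_⟩
    · change freeLift f g (a - b) = 0
      rw [map_sub, sub_eq_zero]
      -- In the relations that involve a bracket of factors, `hM` or `hN` kills the left side and
      -- the trivial action kills the right side.
      cases h <;> simp [freeLift_symL, freeLift_symR, freeLift_mul, hM, hN, LeibnizAction.trivial]
    · change freeLift f g (_ - (_ - _)) = 0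
      simp only [map_sub, freeLift_mul, sub_zero]

theorem lift_mkL (hM : ∀ m m' : M, br F m m' = 0) (hN : ∀ n n' : N, br F n n' = 0)
    (f : M →ₗ[F] N →ₗ[F] V) (g : N →ₗ[F] M →ₗ[F] V) (m : M) (n : N) :
    lift hM hN f g (mkL _ _ m n) = f m n := freeLift_symL f g m n

theorem lift_mkR (hM : ∀ m m' : M, br F m m' = 0) (hN : ∀ n n' : N, br F n n' = 0)
    (f : M →ₗ[F] N →ₗ[F] V) (g : N →ₗ[F] M →ₗ[F] V) (n : N) (m : M) :
    lift hM hN f g (mkR _ _ n m) = g n m := freeLift_symR f g n m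

end

end NonabelianTensor

/-! ### Generators and the universal property of `B` -/

namespace LeibnizCrossedModule

section

variable {F : Type*} {M G V : Type*} [Field F]
  [AddCommGroup M] [Module F M] [LeibnizAlgebra F M]
  [AddCommGroup G] [Module F G] [LeibnizAlgebra F G] [AddCommGroup V] [Module F V]
  (δ : LeibnizCrossedModule F M G)

theorem commutator_le {S : Submodule F M} (h₁ : ∀ x m, δ.act.left x m ∈ S)
    (h₂ : ∀ x m, δ.act.right m x ∈ S) : δ.commutator.toSubmodule ≤ S := by
  refine Submodule.span_le.2 ?_
  rintro _ (⟨x, m, rfl⟩ | ⟨x, m, rfl⟩)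
  exacts [h₁ x m, h₂ x m]

theorem derived_le {S : Submodule F G} (h : ∀ x y, br F x y ∈ S) :
    (LeibnizIdeal.derived F G).toSubmodule ≤ S := by
  refine Submodule.span_le.2 ?_
  rintro _ ⟨x, y, rfl⟩
  exact h x y

theorem coinv_br (a b : δ.Coinv) : br F a b = 0 := by
  obtain ⟨a, rfl⟩ := Submodule.mkQ_surjective _ a
  obtain ⟨b, rfl⟩ := Submodule.mkQ_surjective _ b
  exact δ.mbar_br a b

theorem ab_br (a b : Ab F G) : br F a b = 0 := by
  obtain ⟨a, rfl⟩ := Submodule.mkQ_surjective _ a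
  obtain ⟨b, rfl⟩ := Submodule.mkQ_surjective _ b
  exact gbar_br a b

end

/-- The bilinear map on quotients induced by a bilinear map. -/
def liftQ₂ {F M N V : Type*} [Field F] [AddCommGroup M] [Module F M] [AddCommGroup N] [Module F N]
    [AddCommGroup V] [Module F V] (p : Submodule F M) (q : Submodule F N) (f : M →ₗ[F] N →ₗ[F] V)
    (hp : p ≤ LinearMap.ker f) (hq : q ≤ LinearMap.ker f.flip) : (M ⧸ p) →ₗ[F] (N ⧸ q) →ₗ[F] V :=
  (q.liftQ (p.liftQ f hp).flip fun n hn => by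
    refine LinearMap.mem_ker.2 (Submodule.linearMap_qext _ (LinearMap.ext fun m => ?_))
    exact congr($(LinearMap.mem_ker.1 (hq hn)) m)).flip

section

variable {F : Type*} {M₁ M₂ G₁ G₂ : Type*} [Field F]
  [AddCommGroup M₁] [Module F M₁] [LeibnizAlgebra F M₁]
  [AddCommGroup M₂] [Module F M₂] [LeibnizAlgebra F M₂]
  [AddCommGroup G₁] [Module F G₁] [LeibnizAlgebra F G₁]
  [AddCommGroup G₂] [Module F G₂] [LeibnizAlgebra F G₂]
  (δ₁ : LeibnizCrossedModule F M₁ G₁) (δ₂ : LeibnizCrossedModule F M₂ G₂)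
  {V : Type*} [AddCommGroup V] [Module F V]

/-- `(m₁, x₂) ↦ (m̄₁ ∗ x̄₂, 0) + 𝔞`. -/
def bMG : M₁ →ₗ[F] G₂ →ₗ[F] B δ₁ δ₂ :=
  (tMG G₂ δ₁).compr₂ ((idealA δ₁ δ₂).toSubmodule.mkQ ∘ₗ LinearMap.inl F _ _)

/-- `(x₂, m₁) ↦ (x̄₂ ∗ m̄₁, 0) + 𝔞`. -/
def bMG' : G₂ →ₗ[F] M₁ →ₗ[F] B δ₁ δ₂ :=
  (tMG' G₂ δ₁).compr₂ ((idealA δ₁ δ₂).toSubmodule.mkQ ∘ₗ LinearMap.inl F _ _)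

/-- `(m₂, x₁) ↦ (0, -x̄₁ ∗ m̄₂) + 𝔞`. -/
def bGM : M₂ →ₗ[F] G₁ →ₗ[F] B δ₁ δ₂ :=
  ((tGM G₁ δ₂).compr₂ (-((idealA δ₁ δ₂).toSubmodule.mkQ ∘ₗ LinearMap.inr F _ _))).flip

/-- `(x₁, m₂) ↦ (0, -m̄₂ ∗ x̄₁) + 𝔞`. -/
def bGM' : G₁ →ₗ[F] M₂ →ₗ[F] B δ₁ δ₂ :=
  ((tGM' G₁ δ₂).compr₂ (-((idealA δ₁ δ₂).toSubmodule.mkQ ∘ₗ LinearMap.inr F _ _))).flip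

theorem mkQ_neg (s : TensorMG (G₂ := G₂) δ₁) (t : TensorGM (G₁ := G₁) δ₂) :
    (idealA δ₁ δ₂).toSubmodule.mkQ (s, -t) = (idealA δ₁ δ₂).toSubmodule.mkQ (s, 0) +
      -(idealA δ₁ δ₂).toSubmodule.mkQ (0, t) := by
  rw [← LinearMap.map_neg, ← map_add, Prod.neg_mk, Prod.mk_add_mk, neg_zero, add_zero, zero_add]

theorem leftB_eq (x : G₁ × G₂) (m : M₁ × M₂) :
    leftB δ₁ δ₂ x m = bMG δ₁ δ₂ m.1 x.2 + bGM δ₁ δ₂ m.2 x.1 := by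
  exact mkQ_neg δ₁ δ₂ _ _

theorem rightB_eq (x : G₁ × G₂) (m : M₁ × M₂) :
    rightB δ₁ δ₂ m x = bMG' δ₁ δ₂ x.2 m.1 + bGM' δ₁ δ₂ x.1 m.2 := by
  exact mkQ_neg δ₁ δ₂ _ _

/-- This and `bGM_hom` are the generators of `𝔞`. The sign built into `bGM` and `bGM'` turns them
into gluing conditions, one for each mixed block of the 2-chains. -/
theorem bMG_hom (m₁ : M₁) (m₂ : M₂) :
    bMG δ₁ δ₂ m₁ (δ₂.hom m₂) = bGM' δ₁ δ₂ (δ₁.hom m₁) m₂ := by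
  simpa [leftB_eq, rightB_eq] using (rightB_hom δ₁ δ₂ (0, m₂) (m₁, 0)).symm

theorem bGM_hom (m₁ : M₁) (m₂ : M₂) :
    bGM δ₁ δ₂ m₂ (δ₁.hom m₁) = bMG' δ₁ δ₂ (δ₂.hom m₂) m₁ := by
  simpa [leftB_eq, rightB_eq] using (rightB_hom δ₁ δ₂ (m₁, 0) (0, m₂)).symm

theorem bMG_eq_zero {m : M₁} (hm : m ∈ δ₁.commutator.toSubmodule) (x : G₂) :
    bMG δ₁ δ₂ m x = 0 := by
  simpa [leftB_eq] using leftB_eq_zero δ₁ δ₂ (0, x) (m := (m, 0)) (by simpa using hm) (map_zero _)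

theorem bMG'_eq_zero {m : M₁} (hm : m ∈ δ₁.commutator.toSubmodule) (x : G₂) :
    bMG' δ₁ δ₂ x m = 0 := by
  simpa [rightB_eq] using
    rightB_eq_zero δ₁ δ₂ (0, x) (m := (m, 0)) (by simpa using hm) (map_zero _)

theorem bGM_eq_zero {m : M₂} (hm : m ∈ δ₂.commutator.toSubmodule) (x : G₁) :
    bGM δ₁ δ₂ m x = 0 := by
  simpa [leftB_eq] using leftB_eq_zero δ₁ δ₂ (x, 0) (m := (0, m)) (map_zero _) (by simpa using hm)

theorem bGM'_eq_zero {m : M₂} (hm : m ∈ δ₂.commutator.toSubmodule) (x : G₁) :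
    bGM' δ₁ δ₂ x m = 0 := by
  simpa [rightB_eq] using
    rightB_eq_zero δ₁ δ₂ (x, 0) (m := (0, m)) (map_zero _) (by simpa using hm)

theorem bMG_br (m : M₁) (x y : G₂) : bMG δ₁ δ₂ m (br F x y) = 0 := by
  simpa [leftB_eq, LeibnizAlgebra.prod_br] using leftB_br δ₁ δ₂ (0, x) (0, y) (m, 0)

theorem bMG'_br (m : M₁) (x y : G₂) : bMG' δ₁ δ₂ (br F x y) m = 0 := by
  simpa [rightB_eq, LeibnizAlgebra.prod_br] using rightB_br δ₁ δ₂ (0, x) (0, y) (m, 0)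

theorem bGM_br (m : M₂) (x y : G₁) : bGM δ₁ δ₂ m (br F x y) = 0 := by
  simpa [leftB_eq, LeibnizAlgebra.prod_br] using leftB_br δ₁ δ₂ (x, 0) (y, 0) (0, m)

theorem bGM'_br (m : M₂) (x y : G₁) : bGM' δ₁ δ₂ (br F x y) m = 0 := by
  simpa [rightB_eq, LeibnizAlgebra.prod_br] using rightB_br δ₁ δ₂ (x, 0) (y, 0) (0, m)

/-- To check that a submodule of `B` is everything, it suffices to consider the symbols. -/
theorem mem_of_symbols_mem {S : Submodule F (B δ₁ δ₂)} (h₁ : ∀ m x, bMG δ₁ δ₂ m x ∈ S)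
    (h₂ : ∀ x m, bMG' δ₁ δ₂ x m ∈ S) (h₃ : ∀ m x, bGM δ₁ δ₂ m x ∈ S)
    (h₄ : ∀ x m, bGM' δ₁ δ₂ x m ∈ S) (z : B δ₁ δ₂) : z ∈ S := by
  obtain ⟨⟨s, t⟩, rfl⟩ := Submodule.mkQ_surjective _ z
  have hs : NonabelianTensor.symbols _ _ ≤
      S.comap ((idealA δ₁ δ₂).toSubmodule.mkQ ∘ₗ LinearMap.inl F _ _) := by
    refine NonabelianTensor.symbols_le (fun m x => ?_) (fun x m => ?_) <;>
    obtain ⟨m, rfl⟩ := Submodule.mkQ_surjective _ m <;>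
    obtain ⟨x, rfl⟩ := Submodule.mkQ_surjective _ x
    exacts [h₁ m x, h₂ x m]
  have ht : NonabelianTensor.symbols _ _ ≤
      S.comap (-((idealA δ₁ δ₂).toSubmodule.mkQ ∘ₗ LinearMap.inr F _ _)) := by
    refine NonabelianTensor.symbols_le (fun m x => ?_) (fun x m => ?_) <;>
    obtain ⟨m, rfl⟩ := Submodule.mkQ_surjective _ m <;>
    obtain ⟨x, rfl⟩ := Submodule.mkQ_surjective _ x
    exacts [h₃ x m, h₄ m x]
  -- The inclusion in `ht` carries a minus sign, so `(s, t)` is a difference.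
  have h := S.sub_mem (hs (NonabelianTensor.mem_symbols s)) (ht (NonabelianTensor.mem_symbols t))
  simpa [← Submodule.Quotient.mk_add] using h

/-- Linear maps out of `B`. -/
theorem exists_lift_B (f : M₁ →ₗ[F] G₂ →ₗ[F] V) (f' : G₂ →ₗ[F] M₁ →ₗ[F] V)
    (g : M₂ →ₗ[F] G₁ →ₗ[F] V) (g' : G₁ →ₗ[F] M₂ →ₗ[F] V)
    (hf : δ₁.commutator.toSubmodule ≤ LinearMap.ker f)
    (hfd : (LeibnizIdeal.derived F G₂).toSubmodule ≤ LinearMap.ker f.flip)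
    (hf' : δ₁.commutator.toSubmodule ≤ LinearMap.ker f'.flip)
    (hfd' : (LeibnizIdeal.derived F G₂).toSubmodule ≤ LinearMap.ker f')
    (hg : δ₂.commutator.toSubmodule ≤ LinearMap.ker g)
    (hgd : (LeibnizIdeal.derived F G₁).toSubmodule ≤ LinearMap.ker g.flip)
    (hg' : δ₂.commutator.toSubmodule ≤ LinearMap.ker g'.flip)
    (hgd' : (LeibnizIdeal.derived F G₁).toSubmodule ≤ LinearMap.ker g')
    (hfg : ∀ m₁ m₂, f m₁ (δ₂.hom m₂) = g' (δ₁.hom m₁) m₂)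
    (hgf : ∀ m₁ m₂, g m₂ (δ₁.hom m₁) = f' (δ₂.hom m₂) m₁) :
    ∃ L : B δ₁ δ₂ →ₗ[F] V, (∀ m x, L (bMG δ₁ δ₂ m x) = f m x) ∧
      (∀ x m, L (bMG' δ₁ δ₂ x m) = f' x m) ∧ (∀ m x, L (bGM δ₁ δ₂ m x) = g m x) ∧
      ∀ x m, L (bGM' δ₁ δ₂ x m) = g' x m := by
  let L₁ : TensorMG (G₂ := G₂) δ₁ →ₗ[F] V :=
    NonabelianTensor.lift δ₁.coinv_br ab_br (liftQ₂ _ _ f hf hfd) (liftQ₂ _ _ f' hfd' hf')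
  let L₂ : TensorGM (G₁ := G₁) δ₂ →ₗ[F] V :=
    NonabelianTensor.lift ab_br δ₂.coinv_br (liftQ₂ _ _ g.flip hgd hg)
      (liftQ₂ _ _ g'.flip hg' hgd')
  have e₁ m x : L₁ (tMG G₂ δ₁ m x) = f m x := NonabelianTensor.lift_mkL _ _ _ _ _ _
  have e₂ x m : L₁ (tMG' G₂ δ₁ x m) = f' x m := NonabelianTensor.lift_mkR _ _ _ _ _ _
  have e₃ x m : L₂ (tGM G₁ δ₂ x m) = g m x := NonabelianTensor.lift_mkL _ _ _ _ _ _
  have e₄ m x : L₂ (tGM' G₁ δ₂ m x) = g' x m := NonabelianTensor.lift_mkR _ _ _ _ _ _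
  -- The minus sign on `L₂` matches the one in `bGM` and `bGM'`. Since all brackets vanish, every
  -- subspace is an ideal, and only the generators of `𝔞` need checking.
  have hL : (idealA δ₁ δ₂).toSubmodule ≤ LinearMap.ker (L₁.coprod (-L₂)) := by
    have h0 (x y : TensorMG (G₂ := G₂) δ₁ × TensorGM (G₁ := G₁) δ₂) : br F x y = 0 :=
      Prod.ext (NonabelianTensor.br_eq_zero _ _) (NonabelianTensor.br_eq_zero _ _)
    refine sInf_le ⟨?_, fun x y _ => by rw [h0]; exact zero_mem _,
      fun x y _ => by rw [h0]; exact zero_mem _⟩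
    rintro _ (⟨m₁, m₂, rfl⟩ | ⟨m₁, m₂, rfl⟩)
    · simp [e₁, e₄, hfg]
    · simp [e₂, e₃, hgf]
  refine ⟨(idealA δ₁ δ₂).toSubmodule.liftQ _ hL, fun m x => ?_, fun x m => ?_, fun m x => ?_,
    fun x m => ?_⟩
  · simp [bMG, e₁]
  · simp [bMG', e₂]
  · simp [bGM, e₃]
  · simp [bGM', e₄]

end

end LeibnizCrossedModule

/-! ### Boundaries of tensors with commuting entries -/

namespace LeibnizHomology

section

variable {F : Type*} {G Q : Type*} [Field F]
  [AddCommGroup G] [Module F G] [LeibnizAlgebra F G] [AddCommGroup Q] [Module F Q]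
  {π : G →ₗ[F] Q}

theorem d3_mem_relBoundaries {x y z : G} (h : π x = 0 ∨ π y = 0 ∨ π z = 0) :
    d3 F G ((x ⊗ₜ y) ⊗ₜ z) ∈ relBoundaries π := by
  refine ⟨_, ?_, rfl⟩
  rw [SetLike.mem_coe, LinearMap.mem_ker, TensorProduct.map_tmul, TensorProduct.map_tmul]
  obtain h | h | h := h <;> simp [h]

/-- Under the vanishing assumptions only one of the three terms of `∂₃(x ⊗ y ⊗ z)` survives. This
and `mkQ_tmul_br` are the source of the relations in the mixed blocks. -/
theorem mkQ_br_tmul {x y z : G} (h : π x = 0 ∨ π y = 0 ∨ π z = 0) (hxz : br F x z = 0)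
    (hyz : br F y z = 0) : (relBoundaries π).mkQ (br F x y ⊗ₜ z) = 0 := by
  have := d3_mem_relBoundaries h
  rw [d3_tmul, hxz, hyz, TensorProduct.zero_tmul, TensorProduct.tmul_zero, sub_zero,
    sub_zero] at this
  exact (Submodule.Quotient.mk_eq_zero _).2 this

theorem mkQ_tmul_br {x y z : G} (h : π x = 0 ∨ π y = 0 ∨ π z = 0) (hxy : br F x y = 0)
    (hxz : br F x z = 0) : (relBoundaries π).mkQ (x ⊗ₜ br F y z) = 0 := by
  have := d3_mem_relBoundaries h
  rw [d3_tmul, hxz, hxy, TensorProduct.zero_tmul, TensorProduct.zero_tmul, sub_zero, zero_sub,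
    Submodule.neg_mem_iff] at this
  exact (Submodule.Quotient.mk_eq_zero _).2 this

theorem tmul_mem_relCycles {x y : G} (h : π x = 0 ∨ π y = 0) (hxy : br F x y = 0) :
    x ⊗ₜ y ∈ relCycles π := by
  refine mem_relCycles.2 ⟨hxy, ?_⟩
  obtain h | h := h <;> simp [h]

variable (π) in
/-- The relative homology as a subspace of the quotient of all chains by the boundaries. -/
def kerH2EquivMap : KerH2 π ≃ₗ[F] (relCycles π).map (relBoundaries π).mkQ :=
  Submodule.quotEquivOfEq _ _ (by rw [LinearMap.ker_comp, Submodule.ker_mkQ]; rfl) ≪≫ₗ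
    ((relBoundaries π).mkQ ∘ₗ (relCycles π).subtype).quotKerEquivRange ≪≫ₗ
    LinearEquiv.ofEq _ _ (by rw [LinearMap.range_comp, Submodule.range_subtype])

end

end LeibnizHomology

/-! ### Relative boundaries in a mixed block -/

namespace LeibnizCrossedModule

open LeibnizHomology TensorProduct

section

variable {F : Type*} {M₁ M₂ G₁ G₂ : Type*} [Field F]
  [AddCommGroup M₁] [Module F M₁] [LeibnizAlgebra F M₁]
  [AddCommGroup M₂] [Module F M₂] [LeibnizAlgebra F M₂]
  [AddCommGroup G₁] [Module F G₁] [LeibnizAlgebra F G₁]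
  [AddCommGroup G₂] [Module F G₂] [LeibnizAlgebra F G₂]
  (δ₁ : LeibnizCrossedModule F M₁ G₁) (δ₂ : LeibnizCrossedModule F M₂ G₂)

/-- A pair of bilinear maps on `M₁ × G₂` and `G₁ × M₂` that vanish on commutators and agree on
`M₁ × M₂` vanishes on all preimages of the image in `G₁ ⊗ G₂` of a relative boundary. -/
theorem lift_add_lift_eq_zero_of_boundary {G Q V : Type*} [AddCommGroup G] [Module F G]
    [LeibnizAlgebra F G] [AddCommGroup Q] [Module F Q] [AddCommGroup V] [Module F V]
    {π : G →ₗ[F] Q} {p₁ : G →ₗ[F] G₁} {p₂ : G →ₗ[F] G₂}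
    (hp₁ : ∀ x y, p₁ (br F x y) = br F (p₁ x) (p₁ y))
    (hp₂ : ∀ x y, p₂ (br F x y) = br F (p₂ x) (p₂ y))
    (hπ₁ : ∀ x, π x = 0 → p₁ x ∈ LinearMap.range δ₁.hom)
    (hπ₂ : ∀ x, π x = 0 → p₂ x ∈ LinearMap.range δ₂.hom)
    (hδ₁ : LinearMap.ker δ₁.hom ≤ δ₁.commutator.toSubmodule)
    (hδ₂ : LinearMap.ker δ₂.hom ≤ δ₂.commutator.toSubmodule)
    (f : M₁ →ₗ[F] G₂ →ₗ[F] V) (g : G₁ →ₗ[F] M₂ →ₗ[F] V)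
    (hf : ∀ {m}, m ∈ δ₁.commutator.toSubmodule → ∀ x, f m x = 0)
    (hfd : ∀ m x y, f m (br F x y) = 0)
    (hg : ∀ {m}, m ∈ δ₂.commutator.toSubmodule → ∀ x, g x m = 0)
    (hgd : ∀ m x y, g (br F x y) m = 0)
    (hfg : ∀ m m', f m (δ₂.hom m') = g (δ₁.hom m) m')
    {t : G ⊗[F] G} (ht : t ∈ relBoundaries π) {a : M₁ ⊗[F] G₂} {b : G₁ ⊗[F] M₂}
    (h : δ₁.hom.rTensor G₂ a + δ₂.hom.lTensor G₁ b = map p₁ p₂ t) :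
    lift f a + lift g b = 0 := by
  let φ := (δ₁.hom.rTensor G₂).coprod (δ₂.hom.lTensor G₁)
  let ψ := (lift f).coprod (lift g)
  -- `T` consists of the tensors having at least one preimage on which the pair `f`, `g` vanishes.
  -- Once the boundary is known to lie in `T`, all its preimages are compared with a good one.
  let T := (LinearMap.ker ψ).map φ
  have hT₁ {m x} (h : f m x = 0) : δ₁.hom m ⊗ₜ x ∈ T := ⟨(m ⊗ₜ x, 0), by simp [ψ, h], by simp [φ]⟩
  have hT₂ {x m} (h : g x m = 0) : x ⊗ₜ δ₂.hom m ∈ T := ⟨(0, x ⊗ₜ m), by simp [ψ, h], by simp [φ]⟩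
  have h₁ {u} (hu : π u = 0) (v x) : br F (p₁ u) v ⊗ₜ x ∈ T := by
    obtain ⟨m, hm⟩ := hπ₁ u hu
    rw [← hm, ← δ₁.hom_right]
    exact hT₁ (hf (Submodule.subset_span (Or.inr ⟨v, m, rfl⟩)) x)
  have h₂ {u} (hu : π u = 0) (v x) : br F v (p₁ u) ⊗ₜ x ∈ T := by
    obtain ⟨m, hm⟩ := hπ₁ u hu
    rw [← hm, ← δ₁.hom_left]
    exact hT₁ (hf (Submodule.subset_span (Or.inl ⟨v, m, rfl⟩)) x)
  have h₃ {u} (hu : π u = 0) (v x) : br F v x ⊗ₜ p₂ u ∈ T := by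
    obtain ⟨m, hm⟩ := hπ₂ u hu
    rw [← hm]
    exact hT₂ (hgd m v x)
  have h₄ {u} (hu : π u = 0) (v x) : x ⊗ₜ br F (p₂ u) v ∈ T := by
    obtain ⟨m, hm⟩ := hπ₂ u hu
    rw [← hm, ← δ₂.hom_right]
    exact hT₂ (hg (Submodule.subset_span (Or.inr ⟨v, m, rfl⟩)) x)
  have h₅ {u} (hu : π u = 0) (v x) : x ⊗ₜ br F v (p₂ u) ∈ T := by
    obtain ⟨m, hm⟩ := hπ₂ u hu
    rw [← hm, ← δ₂.hom_left]
    exact hT₂ (hg (Submodule.subset_span (Or.inl ⟨v, m, rfl⟩)) x)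
  have h₆ {u} (hu : π u = 0) (v x) : p₁ u ⊗ₜ br F v x ∈ T := by
    obtain ⟨m, hm⟩ := hπ₁ u hu
    rw [← hm]
    exact hT₁ (hfd m v x)
  -- Each term of `∂₃` on a relative pure tensor has a relative entry and a bracket. If the relative
  -- entry is inside the bracket, the term lifts to a commutator. Otherwise the other factor is a
  -- bracket in `G₁` or `G₂`. Both cases are killed by `f` and `g`.
  have key : LinearMap.ker (map (map π π) π) ≤ T.comap (map p₁ p₂ ∘ₗ d3 F G) := by
    refine ker_map_map_le (fun x hx y z => ?_) (fun x y hy z => ?_) (fun x y z hz => ?_) <;>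
      rw [Submodule.mem_comap, LinearMap.comp_apply, d3_tmul, map_sub, map_sub, map_tmul, map_tmul,
      map_tmul, hp₁, hp₁, hp₂]
    · exact T.sub_mem (T.sub_mem (h₁ hx _ _) (h₁ hx _ _)) (h₆ hx _ _)
    · exact T.sub_mem (T.sub_mem (h₂ hy _ _) (h₃ hy _ _)) (h₄ hy _ _)
    · exact T.sub_mem (T.sub_mem (h₃ hz _ _) (h₂ hz _ _)) (h₅ hz _ _)
  obtain ⟨c, hc, rfl⟩ := ht
  obtain ⟨⟨a', b'⟩, hab, e⟩ := key hc
  have hψ : lift f a' + lift g b' = 0 := hab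
  -- The given preimage and the good one differ by an element of the kernel of `φ`, where
  -- `lift_add_lift_eq_zero` applies.
  have h' : δ₁.hom.rTensor G₂ (a - a') + δ₂.hom.lTensor G₁ (b - b') = 0 := by
    rw [map_sub, map_sub, sub_add_sub_comm, h]
    exact sub_eq_zero.2 e.symm
  have := lift_add_lift_eq_zero δ₁.hom δ₂.hom f g (fun m hm => hf (hδ₁ hm))
    (fun x m hm => hg (hδ₂ hm) x) hfg _ _ h'
  rwa [map_sub, map_sub, sub_add_sub_comm, hψ, sub_zero] at this

theorem exists_eq_lift_add (z : B δ₁ δ₂) :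
    ∃ (a : M₁ ⊗[F] G₂) (b : G₁ ⊗[F] M₂) (a' : M₂ ⊗[F] G₁) (b' : G₂ ⊗[F] M₁),
      z = (lift (bMG δ₁ δ₂) a + lift (bGM' δ₁ δ₂) b) +
        (lift (bGM δ₁ δ₂) a' + lift (bMG' δ₁ δ₂) b') := by
  have := mem_of_symbols_mem δ₁ δ₂ (S := LinearMap.range
    (((lift (bMG δ₁ δ₂)).coprod (lift (bGM' δ₁ δ₂))).coprod
      ((lift (bGM δ₁ δ₂)).coprod (lift (bMG' δ₁ δ₂)))))
    (fun m x => ⟨((m ⊗ₜ x, 0), (0, 0)), by simp⟩) (fun x m => ⟨((0, 0), (0, x ⊗ₜ m)), by simp⟩)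
    (fun m x => ⟨((0, 0), (m ⊗ₜ x, 0)), by simp⟩) (fun x m => ⟨((0, x ⊗ₜ m), (0, 0)), by simp⟩) z
  obtain ⟨⟨⟨a, b⟩, ⟨a', b'⟩⟩, rfl⟩ := this
  exact ⟨a, b, a', b', rfl⟩

end

section

variable {F : Type*} {G₁ G₂ : Type*} [Field F]
  [AddCommGroup G₁] [Module F G₁] [AddCommGroup G₂] [Module F G₂]

/-- The decomposition of `(G₁ ⊕ G₂) ⊗ (G₁ ⊕ G₂)`. -/
theorem eq_sum_map_map (t : (G₁ × G₂) ⊗[F] (G₁ × G₂)) :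
    t = map (.inl F G₁ G₂) (.inl F G₁ G₂) (map (.fst F G₁ G₂) (.fst F G₁ G₂) t) +
      map (.inr F G₁ G₂) (.inr F G₁ G₂) (map (.snd F G₁ G₂) (.snd F G₁ G₂) t) +
      map (.inl F G₁ G₂) (.inr F G₁ G₂) (map (.fst F G₁ G₂) (.snd F G₁ G₂) t) +
      map (.inr F G₁ G₂) (.inl F G₁ G₂) (map (.snd F G₁ G₂) (.fst F G₁ G₂) t) := by
  induction t with
  | zero => simp
  | tmul x y =>
    obtain ⟨x₁, x₂⟩ := x
    obtain ⟨y₁, y₂⟩ := y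
    have hx : (x₁, x₂) = (x₁, (0 : G₂)) + ((0 : G₁), x₂) := by simp
    have hy : (y₁, y₂) = (y₁, (0 : G₂)) + ((0 : G₁), y₂) := by simp
    rw [hx, hy, tmul_add, add_tmul, add_tmul]
    simp
    abel
  | add s t hs ht =>
    conv_lhs => rw [hs, ht]
    simp only [map_add]
    abel

end

end LeibnizCrossedModule

/-! ### The Künneth formula -/

namespace LeibnizCrossedModule

open LeibnizHomology TensorProduct

section

variable {F : Type*} {M₁ M₂ G₁ G₂ : Type*} [Field F]
  [AddCommGroup M₁] [Module F M₁] [LeibnizAlgebra F M₁]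
  [AddCommGroup M₂] [Module F M₂] [LeibnizAlgebra F M₂]
  [AddCommGroup G₁] [Module F G₁] [LeibnizAlgebra F G₁]
  [AddCommGroup G₂] [Module F G₂] [LeibnizAlgebra F G₂]
  {n₁ : LeibnizIdeal F G₁} {n₂ : LeibnizIdeal F G₂}
  {δ₁ : LeibnizCrossedModule F M₁ G₁} {δ₂ : LeibnizCrossedModule F M₂ G₂}

variable (n₁ n₂) in
/-- The class of a chain of degree `2` of `G₁ ⊕ G₂` modulo relative boundaries. -/
abbrev cls : (G₁ × G₂) ⊗[F] (G₁ × G₂) →ₗ[F]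
    ((G₁ × G₂) ⊗[F] (G₁ × G₂)) ⧸ relBoundaries (n₁.prod n₂).toSubmodule.mkQ :=
  (relBoundaries (n₁.prod n₂).toSubmodule.mkQ).mkQ

theorem prod_mkQ_eq_zero {x : G₁ × G₂} :
    (n₁.prod n₂).toSubmodule.mkQ x = 0 ↔ x.1 ∈ n₁.toSubmodule ∧ x.2 ∈ n₂.toSubmodule :=
  Submodule.Quotient.mk_eq_zero _

theorem prod_mkQ_inl {x : G₁} (hx : x ∈ n₁.toSubmodule) :
    (n₁.prod n₂).toSubmodule.mkQ (x, 0) = 0 := prod_mkQ_eq_zero.2 ⟨hx, zero_mem _⟩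

theorem prod_mkQ_inr {x : G₂} (hx : x ∈ n₂.toSubmodule) :
    (n₁.prod n₂).toSubmodule.mkQ (0, x) = 0 := prod_mkQ_eq_zero.2 ⟨zero_mem _, hx⟩

/-- The comparison map from `B` to chains modulo relative boundaries. It is well defined because
elements of different summands commute: a mixed tensor with a bracket in one factor and a relative
entry is then a single surviving term of some `∂₃`. The gluing relations hold already for chains. -/
theorem exists_crossMap (h₁ : LinearMap.range δ₁.hom = n₁.toSubmodule)
    (h₂ : LinearMap.range δ₂.hom = n₂.toSubmodule) :
    ∃ L : B δ₁ δ₂ →ₗ[F] _,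
      (∀ m x, L (bMG δ₁ δ₂ m x) = cls n₁ n₂ ((δ₁.hom m, 0) ⊗ₜ (0, x))) ∧
      (∀ x m, L (bMG' δ₁ δ₂ x m) = cls n₁ n₂ ((0, x) ⊗ₜ (δ₁.hom m, 0))) ∧
      (∀ m x, L (bGM δ₁ δ₂ m x) = cls n₁ n₂ ((0, δ₂.hom m) ⊗ₜ (x, 0))) ∧
      ∀ x m, L (bGM' δ₁ δ₂ x m) = cls n₁ n₂ ((x, 0) ⊗ₜ (0, δ₂.hom m)) := by
  have i₁ (m) : (n₁.prod n₂).toSubmodule.mkQ (δ₁.hom m, 0) = 0 :=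
    prod_mkQ_inl (h₁ ▸ LinearMap.mem_range_self _ m)
  have i₂ (m) : (n₁.prod n₂).toSubmodule.mkQ (0, δ₂.hom m) = 0 :=
    prod_mkQ_inr (h₂ ▸ LinearMap.mem_range_self _ m)
  have l (x y : G₁) : ((br F x y, 0) : G₁ × G₂) = br F (x, 0) (y, 0) := by
    simp [LeibnizAlgebra.prod_br]
  have r (x y : G₂) : ((0, br F x y) : G₁ × G₂) = br F (0, x) (0, y) := by
    simp [LeibnizAlgebra.prod_br]
  have lr (x : G₁) (y : G₂) : br F ((x, 0) : G₁ × G₂) (0, y) = 0 := by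
    simp [LeibnizAlgebra.prod_br]
  have rl (x : G₂) (y : G₁) : br F ((0, x) : G₁ × G₂) (y, 0) = 0 := by
    simp [LeibnizAlgebra.prod_br]
  let c := (TensorProduct.mk F (G₁ × G₂) (G₁ × G₂)).compr₂ (cls n₁ n₂)
  refine exists_lift_B δ₁ δ₂ (c.compl₁₂ (.inl F G₁ G₂ ∘ₗ δ₁.hom) (.inr F G₁ G₂))
    (c.compl₁₂ (.inr F G₁ G₂) (.inl F G₁ G₂ ∘ₗ δ₁.hom))
    (c.compl₁₂ (.inr F G₁ G₂ ∘ₗ δ₂.hom) (.inl F G₁ G₂))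
    (c.compl₁₂ (.inl F G₁ G₂) (.inr F G₁ G₂ ∘ₗ δ₂.hom))
    (δ₁.commutator_le (fun y m => ?_) (fun y m => ?_)) (derived_le fun y z => ?_)
    (δ₁.commutator_le (fun y m => ?_) (fun y m => ?_)) (derived_le fun y z => ?_)
    (δ₂.commutator_le (fun y m => ?_) (fun y m => ?_)) (derived_le fun y z => ?_)
    (δ₂.commutator_le (fun y m => ?_) (fun y m => ?_)) (derived_le fun y z => ?_)
    (fun _ _ => rfl) (fun _ _ => rfl) <;>
    refine LinearMap.mem_ker.2 (LinearMap.ext fun x => ?_)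
  · change cls n₁ n₂ ((δ₁.hom _, 0) ⊗ₜ (0, x)) = 0
    rw [δ₁.hom_left, l]
    exact mkQ_br_tmul (.inr (.inl (i₁ m))) (lr _ _) (lr _ _)
  · change cls n₁ n₂ ((δ₁.hom _, 0) ⊗ₜ (0, x)) = 0
    rw [δ₁.hom_right, l]
    exact mkQ_br_tmul (.inl (i₁ m)) (lr _ _) (lr _ _)
  · change cls n₁ n₂ ((δ₁.hom x, 0) ⊗ₜ (0, br F y z)) = 0
    rw [r]
    exact mkQ_tmul_br (.inl (i₁ x)) (lr _ _) (lr _ _)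
  · change cls n₁ n₂ ((0, x) ⊗ₜ (δ₁.hom _, 0)) = 0
    rw [δ₁.hom_left, l]
    exact mkQ_tmul_br (.inr (.inr (i₁ m))) (rl _ _) (rl _ _)
  · change cls n₁ n₂ ((0, x) ⊗ₜ (δ₁.hom _, 0)) = 0
    rw [δ₁.hom_right, l]
    exact mkQ_tmul_br (.inr (.inl (i₁ m))) (rl _ _) (rl _ _)
  · change cls n₁ n₂ ((0, br F y z) ⊗ₜ (δ₁.hom x, 0)) = 0
    rw [r]
    exact mkQ_br_tmul (.inr (.inr (i₁ x))) (rl _ _) (rl _ _)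
  · change cls n₁ n₂ ((0, δ₂.hom _) ⊗ₜ (x, 0)) = 0
    rw [δ₂.hom_left, r]
    exact mkQ_br_tmul (.inr (.inl (i₂ m))) (rl _ _) (rl _ _)
  · change cls n₁ n₂ ((0, δ₂.hom _) ⊗ₜ (x, 0)) = 0
    rw [δ₂.hom_right, r]
    exact mkQ_br_tmul (.inl (i₂ m)) (rl _ _) (rl _ _)
  · change cls n₁ n₂ ((0, δ₂.hom x) ⊗ₜ (br F y z, 0)) = 0
    rw [l]
    exact mkQ_tmul_br (.inl (i₂ x)) (rl _ _) (rl _ _)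
  · change cls n₁ n₂ ((x, 0) ⊗ₜ (0, δ₂.hom _)) = 0
    rw [δ₂.hom_left, r]
    exact mkQ_tmul_br (.inr (.inr (i₂ m))) (lr _ _) (lr _ _)
  · change cls n₁ n₂ ((x, 0) ⊗ₜ (0, δ₂.hom _)) = 0
    rw [δ₂.hom_right, r]
    exact mkQ_tmul_br (.inr (.inl (i₂ m))) (lr _ _) (lr _ _)
  · change cls n₁ n₂ ((br F y z, 0) ⊗ₜ (0, δ₂.hom x)) = 0
    rw [l]
    exact mkQ_br_tmul (.inr (.inr (i₂ x))) (lr _ _) (lr _ _)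

theorem fst_br (x y : G₁ × G₂) :
    LinearMap.fst F G₁ G₂ (br F x y) = br F (LinearMap.fst F G₁ G₂ x) (LinearMap.fst F G₁ G₂ y) :=
  rfl

theorem snd_br (x y : G₁ × G₂) :
    LinearMap.snd F G₁ G₂ (br F x y) = br F (LinearMap.snd F G₁ G₂ x) (LinearMap.snd F G₁ G₂ y) :=
  rfl

theorem inl_br (x y : G₁) :
    LinearMap.inl F G₁ G₂ (br F x y) = br F (LinearMap.inl F G₁ G₂ x) (LinearMap.inl F G₁ G₂ y) :=
  by simp [LeibnizAlgebra.prod_br]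

theorem inr_br (x y : G₂) :
    LinearMap.inr F G₁ G₂ (br F x y) = br F (LinearMap.inr F G₁ G₂ x) (LinearMap.inr F G₁ G₂ y) :=
  by simp [LeibnizAlgebra.prod_br]

theorem mkQ_comp_fst : n₁.toSubmodule.mkQ ∘ₗ LinearMap.fst F G₁ G₂ =
    (n₁.prod n₂).toSubmodule.mapQ n₁.toSubmodule (LinearMap.fst F G₁ G₂) (fun _ h => h.1) ∘ₗ
      (n₁.prod n₂).toSubmodule.mkQ := (Submodule.mapQ_mkQ _ _ _).symm

theorem mkQ_comp_snd : n₂.toSubmodule.mkQ ∘ₗ LinearMap.snd F G₁ G₂ =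
    (n₁.prod n₂).toSubmodule.mapQ n₂.toSubmodule (LinearMap.snd F G₁ G₂) (fun _ h => h.2) ∘ₗ
      (n₁.prod n₂).toSubmodule.mkQ := (Submodule.mapQ_mkQ _ _ _).symm

theorem mkQ_comp_inl : (n₁.prod n₂).toSubmodule.mkQ ∘ₗ LinearMap.inl F G₁ G₂ =
    n₁.toSubmodule.mapQ (n₁.prod n₂).toSubmodule (LinearMap.inl F G₁ G₂)
      (fun _ h => ⟨h, zero_mem _⟩) ∘ₗ n₁.toSubmodule.mkQ := (Submodule.mapQ_mkQ _ _ _).symm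

theorem mkQ_comp_inr : (n₁.prod n₂).toSubmodule.mkQ ∘ₗ LinearMap.inr F G₁ G₂ =
    n₂.toSubmodule.mapQ (n₁.prod n₂).toSubmodule (LinearMap.inr F G₁ G₂)
      (fun _ h => ⟨zero_mem _, h⟩) ∘ₗ n₂.toSubmodule.mkQ := (Submodule.mapQ_mkQ _ _ _).symm

variable (n₁ n₂) in
/-- The map on relative homology induced by `G₁ → G₁ ⊕ G₂`. -/
def clsInl : KerH2 n₁.toSubmodule.mkQ →ₗ[F]
    ((G₁ × G₂) ⊗[F] (G₁ × G₂)) ⧸ relBoundaries (n₁.prod n₂).toSubmodule.mkQ :=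
  Submodule.liftQ _ (cls n₁ n₂ ∘ₗ map (.inl F G₁ G₂) (.inl F G₁ G₂) ∘ₗ Submodule.subtype _)
    fun _ ha => (Submodule.Quotient.mk_eq_zero _).2 (map_mem_relBoundaries inl_br mkQ_comp_inl ha)

variable (n₁ n₂) in
/-- The map on relative homology induced by `G₂ → G₁ ⊕ G₂`. -/
def clsInr : KerH2 n₂.toSubmodule.mkQ →ₗ[F]
    ((G₁ × G₂) ⊗[F] (G₁ × G₂)) ⧸ relBoundaries (n₁.prod n₂).toSubmodule.mkQ :=
  Submodule.liftQ _ (cls n₁ n₂ ∘ₗ map (.inr F G₁ G₂) (.inr F G₁ G₂) ∘ₗ Submodule.subtype _)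
    fun _ ha => (Submodule.Quotient.mk_eq_zero _).2 (map_mem_relBoundaries inr_br mkQ_comp_inr ha)

/-- The Künneth formula for the second relative homology of a direct sum. -/
theorem exists_kerH2_prod_equiv (h₁ : LinearMap.range δ₁.hom = n₁.toSubmodule)
    (h₂ : LinearMap.range δ₂.hom = n₂.toSubmodule)
    (hδ₁ : LinearMap.ker δ₁.hom ≤ δ₁.commutator.toSubmodule)
    (hδ₂ : LinearMap.ker δ₂.hom ≤ δ₂.commutator.toSubmodule) :
    Nonempty (((KerH2 n₁.toSubmodule.mkQ × KerH2 n₂.toSubmodule.mkQ) × B δ₁ δ₂) ≃ₗ[F]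
      KerH2 (n₁.prod n₂).toSubmodule.mkQ) := by
  obtain ⟨L, hL, hL', hL₂, hL₂'⟩ := exists_crossMap h₁ h₂
  have m₁ (m) : δ₁.hom m ∈ n₁.toSubmodule := h₁ ▸ LinearMap.mem_range_self _ m
  have m₂ (m) : δ₂.hom m ∈ n₂.toSubmodule := h₂ ▸ LinearMap.mem_range_self _ m
  -- The target is all chains modulo boundaries, so that no map into cycles has to be built. Landing
  -- in the cycles becomes part of the computation of the range.
  let Ξ := ((clsInl n₁ n₂).coprod (clsInr n₁ n₂)).coprod L
  have hrange : LinearMap.range Ξ =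
      (relCycles (n₁.prod n₂).toSubmodule.mkQ).map (cls n₁ n₂) := by
    refine le_antisymm ?_ ?_
    · rw [LinearMap.range_le_iff_comap, eq_top_iff]
      rintro ⟨⟨s, t⟩, z⟩ -
      obtain ⟨s, rfl⟩ := Submodule.mkQ_surjective _ s
      obtain ⟨t, rfl⟩ := Submodule.mkQ_surjective _ t
      have hz : z ∈ ((relCycles (n₁.prod n₂).toSubmodule.mkQ).map (cls n₁ n₂)).comap L := by
        refine mem_of_symbols_mem δ₁ δ₂ (fun m x => ?_) (fun x m => ?_) (fun m x => ?_)
          (fun x m => ?_) z <;> rw [Submodule.mem_comap]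
        · rw [hL]
          exact Submodule.mem_map_of_mem (tmul_mem_relCycles (.inl (prod_mkQ_inl (m₁ m)))
            (by simp [LeibnizAlgebra.prod_br]))
        · rw [hL']
          exact Submodule.mem_map_of_mem (tmul_mem_relCycles (.inr (prod_mkQ_inl (m₁ m)))
            (by simp [LeibnizAlgebra.prod_br]))
        · rw [hL₂]
          exact Submodule.mem_map_of_mem (tmul_mem_relCycles (.inl (prod_mkQ_inr (m₂ m)))
            (by simp [LeibnizAlgebra.prod_br]))
        · rw [hL₂']
          exact Submodule.mem_map_of_mem (tmul_mem_relCycles (.inr (prod_mkQ_inr (m₂ m)))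
            (by simp [LeibnizAlgebra.prod_br]))
      exact add_mem (add_mem
        (Submodule.mem_map_of_mem (map_mem_relCycles inl_br mkQ_comp_inl s.2))
        (Submodule.mem_map_of_mem (map_mem_relCycles inr_br mkQ_comp_inr t.2))) hz
    · rintro _ ⟨t, ht, rfl⟩
      have hker := (mem_relCycles.1 ht).2
      -- The diagonal blocks of a relative cycle are relative cycles by functoriality. A mixed block
      -- lies in the kernel of the tensor product of the two quotient maps, hence is spanned by
      -- tensors with one entry in `n₁` or `n₂`, which are values of `L`.
      rw [eq_sum_map_map t, map_add, map_add, map_add]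
      refine add_mem (add_mem (add_mem ?_ ?_) ?_) ?_
      · exact ⟨((Submodule.mkQ _ ⟨_, map_mem_relCycles fst_br mkQ_comp_fst ht⟩, 0), 0),
          by
          simp only [Ξ, LinearMap.coprod_apply, map_zero, add_zero]
          rfl⟩
      · exact ⟨((0, Submodule.mkQ _ ⟨_, map_mem_relCycles snd_br mkQ_comp_snd ht⟩), 0),
          by
          simp only [Ξ, LinearMap.coprod_apply, map_zero, add_zero, zero_add]
          rfl⟩
      · have hle : LinearMap.ker (map n₁.toSubmodule.mkQ n₂.toSubmodule.mkQ) ≤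
            (LinearMap.range Ξ).comap (cls n₁ n₂ ∘ₗ map (.inl F G₁ G₂) (.inr F G₁ G₂)) := by
          refine ker_map_le (fun x hx y => ?_) (fun x y hy => ?_)
          · rw [Submodule.ker_mkQ, ← h₁] at hx
            obtain ⟨m, rfl⟩ := hx
            exact ⟨(0, bMG δ₁ δ₂ m y), by simp [Ξ, hL]⟩
          · rw [Submodule.ker_mkQ, ← h₂] at hy
            obtain ⟨m, rfl⟩ := hy
            exact ⟨(0, bGM' δ₁ δ₂ x m), by simp [Ξ, hL₂']⟩
        refine hle (LinearMap.mem_ker.2 ?_)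
        rw [map_map, mkQ_comp_fst (n₂ := n₂), mkQ_comp_snd (n₁ := n₁), ← map_map, hker, map_zero]
      · have hle : LinearMap.ker (map n₂.toSubmodule.mkQ n₁.toSubmodule.mkQ) ≤
            (LinearMap.range Ξ).comap (cls n₁ n₂ ∘ₗ map (.inr F G₁ G₂) (.inl F G₁ G₂)) := by
          refine ker_map_le (fun x hx y => ?_) (fun x y hy => ?_)
          · rw [Submodule.ker_mkQ, ← h₂] at hx
            obtain ⟨m, rfl⟩ := hx
            exact ⟨(0, bGM δ₁ δ₂ m y), by simp [Ξ, hL₂]⟩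
          · rw [Submodule.ker_mkQ, ← h₁] at hy
            obtain ⟨m, rfl⟩ := hy
            exact ⟨(0, bMG' δ₁ δ₂ x m), by simp [Ξ, hL']⟩
        refine hle (LinearMap.mem_ker.2 ?_)
        rw [map_map, mkQ_comp_fst (n₂ := n₂), mkQ_comp_snd (n₁ := n₁), ← map_map, hker, map_zero]
  have hinj : Function.Injective Ξ := by
    rw [← LinearMap.ker_eq_bot, eq_bot_iff]
    rintro ⟨⟨s, t⟩, z⟩ h
    obtain ⟨⟨s, hs⟩, rfl⟩ := Submodule.mkQ_surjective _ s
    obtain ⟨⟨t, ht⟩, rfl⟩ := Submodule.mkQ_surjective _ t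
    obtain ⟨a, b, a', b', rfl⟩ := exists_eq_lift_add δ₁ δ₂ z
    have k₁ : L ∘ₗ lift (bMG δ₁ δ₂) =
        cls n₁ n₂ ∘ₗ map (.inl F G₁ G₂) (.inr F G₁ G₂) ∘ₗ δ₁.hom.rTensor G₂ := by
      ext m x; simp [hL]
    have k₂ : L ∘ₗ lift (bGM' δ₁ δ₂) =
        cls n₁ n₂ ∘ₗ map (.inl F G₁ G₂) (.inr F G₁ G₂) ∘ₗ δ₂.hom.lTensor G₁ := by
      ext m x; simp [hL₂']
    have k₃ : L ∘ₗ lift (bGM δ₁ δ₂) =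
        cls n₁ n₂ ∘ₗ map (.inr F G₁ G₂) (.inl F G₁ G₂) ∘ₗ δ₂.hom.rTensor G₁ := by
      ext m x; simp [hL₂]
    have k₄ : L ∘ₗ lift (bMG' δ₁ δ₂) =
        cls n₁ n₂ ∘ₗ map (.inr F G₁ G₂) (.inl F G₁ G₂) ∘ₗ δ₁.hom.lTensor G₂ := by
      ext m x; simp [hL']
    -- `u` and `u'` are the mixed blocks of the chain `c` that represents the image of the given
    -- element under `Ξ`. As that image is zero, `c` is a relative boundary, and each of its four
    -- blocks can be examined separately.
    let u := δ₁.hom.rTensor G₂ a + δ₂.hom.lTensor G₁ b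
    let u' := δ₂.hom.rTensor G₁ a' + δ₁.hom.lTensor G₂ b'
    let c := map (.inl F G₁ G₂) (.inl F G₁ G₂) s + map (.inr F G₁ G₂) (.inr F G₁ G₂) t +
      (map (.inl F G₁ G₂) (.inr F G₁ G₂) u + map (.inr F G₁ G₂) (.inl F G₁ G₂) u')
    have hc : c ∈ relBoundaries (n₁.prod n₂).toSubmodule.mkQ := by
      refine (Submodule.Quotient.mk_eq_zero _).1 (Eq.trans ?_ (LinearMap.mem_ker.1 h))
      change cls n₁ n₂ c = cls n₁ n₂ (map _ _ s) + cls n₁ n₂ (map _ _ t) +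
        L ((lift (bMG δ₁ δ₂) a + lift (bGM' δ₁ δ₂) b) +
          (lift (bGM δ₁ δ₂) a' + lift (bMG' δ₁ δ₂) b'))
      rw [map_add L, map_add L, map_add L, ← LinearMap.comp_apply L, ← LinearMap.comp_apply L,
        ← LinearMap.comp_apply L, ← LinearMap.comp_apply L, k₁, k₂, k₃, k₄]
      simp only [c, u, u', map_add, LinearMap.comp_apply]
    have e₁ : map (.fst F G₁ G₂) (.fst F G₁ G₂) c = s := by
      simp [c, map_map, LinearMap.fst_comp_inl, LinearMap.fst_comp_inr]
    have e₂ : map (.snd F G₁ G₂) (.snd F G₁ G₂) c = t := by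
      simp [c, map_map, LinearMap.snd_comp_inl, LinearMap.snd_comp_inr]
    have e₃ : map (.fst F G₁ G₂) (.snd F G₁ G₂) c = u := by
      simp [c, map_map, LinearMap.fst_comp_inl, LinearMap.fst_comp_inr, LinearMap.snd_comp_inl,
        LinearMap.snd_comp_inr]
    have e₄ : map (.snd F G₁ G₂) (.fst F G₁ G₂) c = u' := by
      simp [c, map_map, LinearMap.fst_comp_inl, LinearMap.fst_comp_inr, LinearMap.snd_comp_inl,
        LinearMap.snd_comp_inr]
    have hs' := map_mem_relBoundaries fst_br mkQ_comp_fst hc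
    have ht' := map_mem_relBoundaries snd_br mkQ_comp_snd hc
    rw [e₁] at hs'
    rw [e₂] at ht'
    have p₁ (x : G₁ × G₂) (hx : (n₁.prod n₂).toSubmodule.mkQ x = 0) :
        LinearMap.fst F G₁ G₂ x ∈ LinearMap.range δ₁.hom := h₁ ▸ (prod_mkQ_eq_zero.1 hx).1
    have p₂ (x : G₁ × G₂) (hx : (n₁.prod n₂).toSubmodule.mkQ x = 0) :
        LinearMap.snd F G₁ G₂ x ∈ LinearMap.range δ₂.hom := h₂ ▸ (prod_mkQ_eq_zero.1 hx).2
    -- The two mixed blocks are handled by the same statement with the roles of the summands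
    -- exchanged.
    have z₁ := lift_add_lift_eq_zero_of_boundary δ₁ δ₂ fst_br snd_br p₁ p₂ hδ₁ hδ₂
      (bMG δ₁ δ₂) (bGM' δ₁ δ₂) (bMG_eq_zero δ₁ δ₂) (bMG_br δ₁ δ₂) (bGM'_eq_zero δ₁ δ₂)
      (bGM'_br δ₁ δ₂) (bMG_hom δ₁ δ₂) hc e₃.symm
    have z₂ := lift_add_lift_eq_zero_of_boundary δ₂ δ₁ snd_br fst_br p₂ p₁ hδ₂ hδ₁
      (bGM δ₁ δ₂) (bMG' δ₁ δ₂) (bGM_eq_zero δ₁ δ₂) (bGM_br δ₁ δ₂) (bMG'_eq_zero δ₁ δ₂)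
      (bMG'_br δ₁ δ₂) (fun m m' => bGM_hom δ₁ δ₂ m' m) hc e₄.symm
    rw [z₁, z₂, add_zero]
    refine Prod.ext (Prod.ext ?_ ?_) rfl
    exacts [(Submodule.Quotient.mk_eq_zero _).2 hs', (Submodule.Quotient.mk_eq_zero _).2 ht']
  exact ⟨LinearEquiv.ofInjective Ξ hinj ≪≫ₗ LinearEquiv.ofEq _ _ hrange ≪≫ₗ
    (kerH2EquivMap _).symm⟩

end

end LeibnizCrossedModule

/-! ### Kernel, centre and commutator of the sum -/

namespace LeibnizCrossedModule

open LeibnizHomology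

section

variable {F : Type*} {M₁ M₂ G₁ G₂ : Type*} [Field F]
  [AddCommGroup M₁] [Module F M₁] [LeibnizAlgebra F M₁]
  [AddCommGroup M₂] [Module F M₂] [LeibnizAlgebra F M₂]
  [AddCommGroup G₁] [Module F G₁] [LeibnizAlgebra F G₁]
  [AddCommGroup G₂] [Module F G₂] [LeibnizAlgebra F G₂]
  (δ₁ : LeibnizCrossedModule F M₁ G₁) (δ₂ : LeibnizCrossedModule F M₂ G₂)

theorem mem_ker_sum {u : DirectSum δ₁ δ₂} : u ∈ LinearMap.ker (sum δ₁ δ₂).hom ↔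
    δ₁.hom (DirectSum.toM δ₁ δ₂ u).1 = 0 ∧ δ₂.hom (DirectSum.toM δ₁ δ₂ u).2 = 0 :=
  Prod.mk_eq_zero

/-- `ker δ = ker δ₁ ⊕ ker δ₂ ⊕ B`. -/
def kerSumEquiv : LinearMap.ker (sum δ₁ δ₂).hom ≃ₗ[F]
    (LinearMap.ker δ₁.hom × LinearMap.ker δ₂.hom) × B δ₁ δ₂ where
  toFun u := ((⟨_, ((mem_ker_sum δ₁ δ₂).1 u.2).1⟩, ⟨_, ((mem_ker_sum δ₁ δ₂).1 u.2).2⟩),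
    DirectSum.toB δ₁ δ₂ u)
  invFun t := ⟨DirectSum.mk δ₁ δ₂ (t.1.1, t.1.2) t.2, (mem_ker_sum δ₁ δ₂).2 ⟨t.1.1.2, t.1.2.2⟩⟩
  map_add' _ _ := rfl
  map_smul' _ _ := rfl
  left_inv _ := rfl
  right_inv _ := rfl

theorem range_sum : LinearMap.range (sum δ₁ δ₂).hom =
    (LinearMap.range δ₁.hom).prod (LinearMap.range δ₂.hom) := by
  ext x
  constructor
  · rintro ⟨u, rfl⟩
    exact ⟨⟨_, rfl⟩, ⟨_, rfl⟩⟩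
  · rintro ⟨⟨m₁, h₁⟩, ⟨m₂, h₂⟩⟩
    exact ⟨DirectSum.mk δ₁ δ₂ (m₁, m₂) 0, Prod.ext h₁ h₂⟩

/-- The inclusion of `B`. -/
def inB : B δ₁ δ₂ →ₗ[F] DirectSum δ₁ δ₂ := LinearMap.inr F (M₁ × M₂) (B δ₁ δ₂)

/-- The inclusion of `M₁`. -/
def inM₁ : M₁ →ₗ[F] DirectSum δ₁ δ₂ := LinearMap.inl F (M₁ × M₂) (B δ₁ δ₂) ∘ₗ LinearMap.inl F M₁ M₂

/-- The inclusion of `M₂`. -/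
def inM₂ : M₂ →ₗ[F] DirectSum δ₁ δ₂ := LinearMap.inl F (M₁ × M₂) (B δ₁ δ₂) ∘ₗ LinearMap.inr F M₁ M₂

theorem eq_in_add (u : DirectSum δ₁ δ₂) : u = inM₁ δ₁ δ₂ (DirectSum.toM δ₁ δ₂ u).1 +
    inM₂ δ₁ δ₂ (DirectSum.toM δ₁ δ₂ u).2 + inB δ₁ δ₂ (DirectSum.toB δ₁ δ₂ u) := by
  refine DirectSum.ext ?_ ?_
  · change DirectSum.toM δ₁ δ₂ u = ((DirectSum.toM δ₁ δ₂ u).1, (0 : M₂)) +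
      ((0 : M₁), (DirectSum.toM δ₁ δ₂ u).2) + 0
    simp
  · change DirectSum.toB δ₁ δ₂ u = 0 + 0 + DirectSum.toB δ₁ δ₂ u
    simp

theorem left_inM₁ (x : G₁ × G₂) (m : M₁) : (sum δ₁ δ₂).act.left x (inM₁ δ₁ δ₂ m) =
    inM₁ δ₁ δ₂ (δ₁.act.left x.1 m) + inB δ₁ δ₂ (bMG δ₁ δ₂ m x.2) := by
  refine DirectSum.ext ?_ ?_
  · change (δ₁.act.left x.1 m, δ₂.act.left x.2 0) = (δ₁.act.left x.1 m, (0 : M₂)) + 0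
    simp
  · change leftB δ₁ δ₂ x (m, 0) = 0 + bMG δ₁ δ₂ m x.2
    simp [leftB_eq]

theorem left_inM₂ (x : G₁ × G₂) (m : M₂) : (sum δ₁ δ₂).act.left x (inM₂ δ₁ δ₂ m) =
    inM₂ δ₁ δ₂ (δ₂.act.left x.2 m) + inB δ₁ δ₂ (bGM δ₁ δ₂ m x.1) := by
  refine DirectSum.ext ?_ ?_
  · change (δ₁.act.left x.1 0, δ₂.act.left x.2 m) = ((0 : M₁), δ₂.act.left x.2 m) + 0
    simp
  · change leftB δ₁ δ₂ x (0, m) = 0 + bGM δ₁ δ₂ m x.1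
    simp [leftB_eq]

theorem right_inM₁ (x : G₁ × G₂) (m : M₁) : (sum δ₁ δ₂).act.right (inM₁ δ₁ δ₂ m) x =
    inM₁ δ₁ δ₂ (δ₁.act.right m x.1) + inB δ₁ δ₂ (bMG' δ₁ δ₂ x.2 m) := by
  refine DirectSum.ext ?_ ?_
  · change (δ₁.act.right m x.1, δ₂.act.right 0 x.2) = (δ₁.act.right m x.1, (0 : M₂)) + 0
    simp
  · change rightB δ₁ δ₂ (m, 0) x = 0 + bMG' δ₁ δ₂ x.2 m
    simp [rightB_eq]

theorem right_inM₂ (x : G₁ × G₂) (m : M₂) : (sum δ₁ δ₂).act.right (inM₂ δ₁ δ₂ m) x =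
    inM₂ δ₁ δ₂ (δ₂.act.right m x.2) + inB δ₁ δ₂ (bGM' δ₁ δ₂ x.1 m) := by
  refine DirectSum.ext ?_ ?_
  · change (δ₁.act.right 0 x.1, δ₂.act.right m x.2) = ((0 : M₁), δ₂.act.right m x.2) + 0
    simp
  · change rightB δ₁ δ₂ (0, m) x = 0 + bGM' δ₁ δ₂ x.1 m
    simp [rightB_eq]

theorem left_mem_commutator (x : G₁ × G₂) (u : DirectSum δ₁ δ₂) :
    (sum δ₁ δ₂).act.left x u ∈ (sum δ₁ δ₂).commutator.toSubmodule :=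
  Submodule.subset_span (Or.inl ⟨x, u, rfl⟩)

theorem right_mem_commutator (x : G₁ × G₂) (u : DirectSum δ₁ δ₂) :
    (sum δ₁ δ₂).act.right u x ∈ (sum δ₁ δ₂).commutator.toSubmodule :=
  Submodule.subset_span (Or.inr ⟨x, u, rfl⟩)

/-- Acting with `(x, 0)` on the summand `M₁` produces no `B`-component, so generators of `[G₁, M₁]`
are generators of the large commutator. -/
theorem inM₁_mem_commutator {m : M₁} (hm : m ∈ δ₁.commutator.toSubmodule) :
    inM₁ δ₁ δ₂ m ∈ (sum δ₁ δ₂).commutator.toSubmodule := by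
  refine δ₁.commutator_le (S := (sum δ₁ δ₂).commutator.toSubmodule.comap (inM₁ δ₁ δ₂))
    (fun x m => ?_) (fun x m => ?_) hm <;> rw [Submodule.mem_comap]
  · simpa [left_inM₁] using left_mem_commutator δ₁ δ₂ (x, 0) (inM₁ δ₁ δ₂ m)
  · simpa [right_inM₁] using right_mem_commutator δ₁ δ₂ (x, 0) (inM₁ δ₁ δ₂ m)

theorem inM₂_mem_commutator {m : M₂} (hm : m ∈ δ₂.commutator.toSubmodule) :
    inM₂ δ₁ δ₂ m ∈ (sum δ₁ δ₂).commutator.toSubmodule := by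
  refine δ₂.commutator_le (S := (sum δ₁ δ₂).commutator.toSubmodule.comap (inM₂ δ₁ δ₂))
    (fun x m => ?_) (fun x m => ?_) hm <;> rw [Submodule.mem_comap]
  · simpa [left_inM₂] using left_mem_commutator δ₁ δ₂ (0, x) (inM₂ δ₁ δ₂ m)
  · simpa [right_inM₂] using right_mem_commutator δ₁ δ₂ (0, x) (inM₂ δ₁ δ₂ m)

/-- Acting on one summand with an element of the other Lie factor's side, such as `(0, x)` on `M₁`,
leaves only the `B`-component, and the symbols obtained in this way span `B`. -/
theorem inB_mem_commutator (z : B δ₁ δ₂) :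
    inB δ₁ δ₂ z ∈ (sum δ₁ δ₂).commutator.toSubmodule := by
  refine mem_of_symbols_mem δ₁ δ₂ (S := (sum δ₁ δ₂).commutator.toSubmodule.comap (inB δ₁ δ₂))
    (fun m x => ?_) (fun x m => ?_) (fun m x => ?_) (fun x m => ?_) z <;> rw [Submodule.mem_comap]
  · simpa [left_inM₁] using left_mem_commutator δ₁ δ₂ (0, x) (inM₁ δ₁ δ₂ m)
  · simpa [right_inM₁] using right_mem_commutator δ₁ δ₂ (0, x) (inM₁ δ₁ δ₂ m)
  · simpa [left_inM₂] using left_mem_commutator δ₁ δ₂ (x, 0) (inM₂ δ₁ δ₂ m)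
  · simpa [right_inM₂] using right_mem_commutator δ₁ δ₂ (x, 0) (inM₂ δ₁ δ₂ m)

/-- Both parts of the stem condition enter: centrality kills the components in `M₁` and `M₂`, and
membership in the commutators kills the classes on which the `B`-component depends. -/
theorem mem_center_sum {u : DirectSum δ₁ δ₂} (h₁ : (DirectSum.toM δ₁ δ₂ u).1 ∈
      δ₁.center ⊓ δ₁.commutator.toSubmodule)
    (h₂ : (DirectSum.toM δ₁ δ₂ u).2 ∈ δ₂.center ⊓ δ₂.commutator.toSubmodule) :
    u ∈ (sum δ₁ δ₂).center := fun x =>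
  ⟨DirectSum.ext (Prod.ext (h₁.1 x.1).1 (h₂.1 x.2).1)
    (leftB_eq_zero δ₁ δ₂ x ((Submodule.Quotient.mk_eq_zero _).2 h₁.2)
      ((Submodule.Quotient.mk_eq_zero _).2 h₂.2)),
  DirectSum.ext (Prod.ext (h₁.1 x.1).2 (h₂.1 x.2).2)
    (rightB_eq_zero δ₁ δ₂ x ((Submodule.Quotient.mk_eq_zero _).2 h₁.2)
      ((Submodule.Quotient.mk_eq_zero _).2 h₂.2))⟩

end

end LeibnizCrossedModule

end

theorem theorem4p5 {F : Type*} [Field F] {M₁ M₂ G₁ G₂ : Type*}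
    [AddCommGroup M₁] [Module F M₁] [LeibnizAlgebra F M₁]
    [AddCommGroup M₂] [Module F M₂] [LeibnizAlgebra F M₂]
    [AddCommGroup G₁] [Module F G₁] [LeibnizAlgebra F G₁]
    [AddCommGroup G₂] [Module F G₂] [LeibnizAlgebra F G₂]
    (n₁ : LeibnizIdeal F G₁) (n₂ : LeibnizIdeal F G₂)
    (δ₁ : LeibnizCrossedModule F M₁ G₁) (δ₂ : LeibnizCrossedModule F M₂ G₂)
    (h₁ : δ₁.IsRelativeStemCover n₁) (h₂ : δ₂.IsRelativeStemCover n₂) :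
    (LeibnizCrossedModule.sum δ₁ δ₂).IsRelativeStemCover (n₁.prod n₂) := by
  obtain ⟨e₁⟩ := h₁.ker_equiv
  obtain ⟨e₂⟩ := h₂.ker_equiv
  obtain ⟨e⟩ := LeibnizCrossedModule.exists_kerH2_prod_equiv h₁.range_eq h₂.range_eq
    (h₁.ker_le.trans inf_le_right) (h₂.ker_le.trans inf_le_right)
  refine ⟨?_, ⟨?_⟩, fun u hu => ?_⟩
  · rw [LeibnizCrossedModule.range_sum, h₁.range_eq, h₂.range_eq]
    rfl
  -- `ker δ ≅ ker δ₁ ⊕ ker δ₂ ⊕ B`, then the given isomorphisms with `HL₂(gᵢ, nᵢ)` passed to the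
  -- kernel complexes, then the Künneth isomorphism `e`, then back to the mapping cone.
  · exact LeibnizCrossedModule.kerSumEquiv δ₁ δ₂ ≪≫ₗ
      ((e₁ ≪≫ₗ (LeibnizHomology.kerH2Equiv n₁.br_mk n₁.toSubmodule.mkQ_surjective).symm).prodCongr
        (e₂ ≪≫ₗ (LeibnizHomology.kerH2Equiv n₂.br_mk
          n₂.toSubmodule.mkQ_surjective).symm)).prodCongr (LinearEquiv.refl F _) ≪≫ₗ e ≪≫ₗ
      LeibnizHomology.kerH2Equiv (n₁.prod n₂).br_mk (n₁.prod n₂).toSubmodule.mkQ_surjective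
  · obtain ⟨k₁, k₂⟩ := (LeibnizCrossedModule.mem_ker_sum δ₁ δ₂).1 hu
    have c₁ := h₁.ker_le k₁
    have c₂ := h₂.ker_le k₂
    refine ⟨LeibnizCrossedModule.mem_center_sum δ₁ δ₂ c₁ c₂, ?_⟩
    rw [LeibnizCrossedModule.eq_in_add δ₁ δ₂ u]
    exact add_mem (add_mem (LeibnizCrossedModule.inM₁_mem_commutator δ₁ δ₂ c₁.2)
      (LeibnizCrossedModule.inM₂_mem_commutator δ₁ δ₂ c₂.2))
      (LeibnizCrossedModule.inB_mem_commutator δ₁ δ₂ _)
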